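/- Let $Q=(q_n)_{n\ge 1}$ be a sequence of integers $q_n\ge 2$ with $\lim_{n\to\infty} q_n=\infty$. Every real $x$ has a unique $Q$-Cantor series expansion $$x=E_0+\sum_{n=1}^{\infty}\frac{E_n}{q_1q_2\cdots q_n},\qquad E_0=\lfloor x\rfloor,\quad E_n\in\{0,1,\dots,q_n-1\}\ (n\ge 1),\quad E_n\ne q_n-1\text{ for infinitely many }n.$$ For $n\ge 0$ let $T_{Q,n}(x)\in[0,1)$ be the fractional part of $q_1q_2\cdots q_n\,x$ (so $T_{Q,0}(x)$ is the fractional part of $x$). A sequence $(\omega_n)_{n\ge 0}$ in $[0,1)$ is \emph{u.d. mod 1} if $\lim_{N\to\infty}\frac1N\#\{0\le n<N:\omega_n\in[0,t)\}=t$ for every $t\in[0,1]$. A real number $x$ is called - \emph{$Q$-distribution normal} if $(T_{Q,n}(x))_{n\ge 0}$ is u.d. mod 1 (and likewise for any other sequence of integers $\ge 2$ in place of $Q$); - \emph{AP $Q$-distribution normal of type I} if $(T_{Q,mn+r}(x))_{n\ge 0}$ is u.d. mod 1 for all integers $m\ge 1$ and $0\le r<m$; - \emph{AP $Q$-distribution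 normal of type II} if, for all integers $m\ge 1$ and $1\le r\le m$, the real number $\sum_{n=1}^{\infty}\frac{E_{m(n-1)+r}}{q_r\,q_{m+r}\cdots q_{m(n-1)+r}}$ is $(q_{m(n-1)+r})_{n\ge 1}$-distribution normal; - \emph{AP $Q$-distribution abnormal} if $(T_{Q,mn+r}(x))_{n\ge 0}$ is not u.d. mod 1 for any integers $m>1$ and $0\le r<m$. Then: 1. A real number is AP $Q$-distribution normal of type I if and only if it is AP $Q$-distribution normal of type II. 2. The set of real numbers that are $Q$-distribution normal and AP $Q$-distribution abnormal is meagre in $\mathbb{R}$, has Lebesgue measure zero, and has Hausdorff dimension $1$. -/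

import Mathlib

open Filter Topology MeasureTheory

/-! A sequence of integers `q₁, q₂, …` is a function `q : ℕ → ℕ`; the value `q 0` is never used. -/

namespace CantorSeries

/-- `Q = (q₁, q₂, …)` is a basic sequence: every `qₙ` is an integer that is at least `2`. -/
def IsBasicSequence (q : ℕ → ℕ) : Prop :=
  ∀ n, 1 ≤ n → 2 ≤ q n

/-- `Q` is infinite in limit: `qₙ → ∞`. -/
def InfiniteInLimit (q : ℕ → ℕ) : Prop :=
  Tendsto q atTop atTop

/-- The product `q₁ q₂ ⋯ qₙ`. -/
def partialProd (q : ℕ → ℕ) (n : ℕ) : ℕ :=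
  ∏ i ∈ Finset.Icc 1 n, q i

/-- `T_{Q,n}(x) = qₙ qₙ₋₁ ⋯ q₁ x (mod 1)`, as an element of `[0,1)`. -/
noncomputable def orbit (q : ℕ → ℕ) (x : ℝ) (n : ℕ) : ℝ :=
  Int.fract ((partialProd q n : ℝ) * x)

/-- The digit `Eₙ(x)` of the `Q`-Cantor series expansion of `x`. For a basic sequence this is the
only sequence that satisfies `IsCantorExpansion`; see `isCantorExpansion_iff`. -/
noncomputable def digit (q : ℕ → ℕ) (x : ℝ) : ℕ → ℤ
  | 0 => ⌊x⌋
  | n + 1 => ⌊(q (n + 1) : ℝ) * orbit q x n⌋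

/-- `x = E₀ + ∑_{n ≥ 1} Eₙ / (q₁ ⋯ qₙ)` with `E₀ = ⌊x⌋`, with `Eₙ ∈ {0, …, qₙ - 1}` for `n ≥ 1`, and
with `Eₙ ≠ qₙ - 1` infinitely often. -/
def IsCantorExpansion (q : ℕ → ℕ) (x : ℝ) (E : ℕ → ℤ) : Prop :=
  E 0 = ⌊x⌋ ∧ (∀ n, 1 ≤ n → 0 ≤ E n ∧ E n ≤ (q n : ℤ) - 1) ∧
    (∃ᶠ n in atTop, E n ≠ (q n : ℤ) - 1) ∧
    HasSum (fun n : ℕ => (E (n + 1) : ℝ) / (partialProd q (n + 1) : ℝ)) (x - (E 0 : ℝ))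

/-- The real number `0.E₁E₂E₃⋯` with respect to `Q`, that is `∑_{n ≥ 1} Eₙ / (q₁ ⋯ qₙ)`. -/
noncomputable def fractionValue (q : ℕ → ℕ) (E : ℕ → ℤ) : ℝ :=
  ∑' n : ℕ, (E (n + 1) : ℝ) / (partialProd q (n + 1) : ℝ)

/-- The sequence whose `n`-th term is `a_{m(n-1)+r}` for `n ≥ 1`. -/
def apSubseq {α : Type*} (m r : ℕ) (a : ℕ → α) : ℕ → α :=
  fun n => a (m * (n - 1) + r)

open Classical in
/-- The number of indices among the first `N` whose term lies in `I`. -/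
noncomputable def countIn (I : Set ℝ) (ω : ℕ → ℝ) (N : ℕ) : ℕ :=
  ((Finset.range N).filter (fun i => ω i ∈ I)).card

/-- The sequence `ω₀, ω₁, …` in `[0,1)` has asymptotic distribution function `f` on `[0,1]`. -/
def HasADF (ω : ℕ → ℝ) (f : ℝ → ℝ) : Prop :=
  ∀ t ∈ Set.Icc (0 : ℝ) 1,
    Tendsto (fun N : ℕ => (countIn (Set.Ico 0 t) ω N : ℝ) / (N : ℝ)) atTop (𝓝 (f t))

/-- Uniform distribution mod 1 of a sequence in `[0,1)`. -/
def IsUniformlyDistributed (ω : ℕ → ℝ) : Prop :=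
  HasADF ω (fun t => t)

/-- `x` is `Q`-distribution normal. -/
def DistributionNormal (q : ℕ → ℕ) (x : ℝ) : Prop :=
  IsUniformlyDistributed (orbit q x)

/-- `x` is AP `Q`-distribution normal of type I. -/
def APNormalTypeI (q : ℕ → ℕ) (x : ℝ) : Prop :=
  ∀ m r : ℕ, r < m → IsUniformlyDistributed (fun n => orbit q x (m * n + r))

/-- `x` is AP `Q`-distribution normal of type II: for every residue class modulo every `m ≥ 1`, with
`r` its least positive member, the real number `0.E_r E_{m+r} E_{2m+r} ⋯` with respect to
`(q_r, q_{m+r}, q_{2m+r}, …)` is distribution normal with respect to that basic sequence. -/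
def APNormalTypeII (q : ℕ → ℕ) (x : ℝ) : Prop :=
  ∀ m r : ℕ, 1 ≤ r → r ≤ m →
    DistributionNormal (apSubseq m r q)
      (fractionValue (apSubseq m r q) (apSubseq m r (digit q x)))

/-- `x` is AP `Q`-distribution abnormal. -/
def APAbnormal (q : ℕ → ℕ) (x : ℝ) : Prop :=
  ∀ m r : ℕ, 1 < m → r < m → ¬ IsUniformlyDistributed (fun n => orbit q x (m * n + r))

/-- The set of real numbers that are `Q`-distribution normal and AP `Q`-distribution abnormal. -/
def normalAbnormalSet (q : ℕ → ℕ) : Set ℝ :=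
  {x : ℝ | DistributionNormal q x ∧ APAbnormal q x}

/-! The digits are well defined: they are the unique Cantor series expansion. -/

theorem partialProd_zero (q : ℕ → ℕ) : partialProd q 0 = 1 := by
  simp [partialProd]

theorem partialProd_succ (q : ℕ → ℕ) (n : ℕ) :
    partialProd q (n + 1) = partialProd q n * q (n + 1) := by
  simp [partialProd, Finset.prod_Icc_succ_top]

theorem two_pow_le_partialProd {q : ℕ → ℕ} (hq : IsBasicSequence q) (n : ℕ) :
    2 ^ n ≤ partialProd q n := by
  induction n with
  | zero => simp [partialProd_zero]
  | succ n ih =>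
    rw [partialProd_succ, pow_succ]
    exact Nat.mul_le_mul ih (hq (n + 1) (by omega))

theorem partialProd_pos {q : ℕ → ℕ} (hq : IsBasicSequence q) (n : ℕ) :
    (0 : ℝ) < (partialProd q n : ℝ) := by
  have h := two_pow_le_partialProd hq n
  have h2 : 0 < 2 ^ n := by positivity
  exact_mod_cast lt_of_lt_of_le h2 h

theorem tendsto_inv_partialProd {q : ℕ → ℕ} (hq : IsBasicSequence q) :
    Tendsto (fun n => 1 / (partialProd q n : ℝ)) atTop (𝓝 0) := by
  have h : Tendsto (fun n : ℕ => ((1 : ℝ) / 2) ^ n) atTop (𝓝 0) :=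
    tendsto_pow_atTop_nhds_zero_of_lt_one (by norm_num) (by norm_num)
  refine squeeze_zero (fun n => by positivity) (fun n => ?_) h
  rw [div_pow, one_pow]
  have h2 : ((2 : ℝ) ^ n) ≤ (partialProd q n : ℝ) := by
    exact_mod_cast two_pow_le_partialProd hq n
  exact one_div_le_one_div_of_le (by positivity) h2

theorem digit_zero (q : ℕ → ℕ) (x : ℝ) : digit q x 0 = ⌊x⌋ := rfl

theorem digit_succ (q : ℕ → ℕ) (x : ℝ) (n : ℕ) :
    digit q x (n + 1) = ⌊(q (n + 1) : ℝ) * orbit q x n⌋ := rfl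

theorem orbit_succ (q : ℕ → ℕ) (x : ℝ) (n : ℕ) :
    orbit q x (n + 1) = (q (n + 1) : ℝ) * orbit q x n - (digit q x (n + 1) : ℝ) := by
  rw [digit_succ, ← Int.fract]
  unfold orbit
  rw [partialProd_succ, Int.fract_eq_fract]
  refine ⟨(q (n + 1) : ℤ) * ⌊(partialProd q n : ℝ) * x⌋, ?_⟩
  have h := Int.floor_add_fract ((partialProd q n : ℝ) * x)
  push_cast
  linear_combination (-(q (n + 1) : ℝ)) * h

theorem sum_digit (q : ℕ → ℕ) (hq : IsBasicSequence q) (x : ℝ) (n : ℕ) :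
    ∑ k ∈ Finset.range n, (digit q x (k + 1) : ℝ) / (partialProd q (k + 1) : ℝ) =
      x - ⌊x⌋ - orbit q x n / (partialProd q n : ℝ) := by
  induction n with
  | zero => simp [partialProd_zero, orbit]
  | succ n ih =>
    rw [Finset.sum_range_succ, ih, orbit_succ]
    have h1 := partialProd_pos hq n
    have h2 := partialProd_pos hq (n + 1)
    rw [partialProd_succ] at h2 ⊢
    push_cast at h2 ⊢
    have h3 : (q (n + 1) : ℝ) ≠ 0 := by
      rintro h
      simp [h] at h2
    field_simp
    ring

theorem digit_bounds (q : ℕ → ℕ) (hq : IsBasicSequence q) (x : ℝ) (n : ℕ) (hn : 1 ≤ n) :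
    0 ≤ digit q x n ∧ digit q x n ≤ (q n : ℤ) - 1 := by
  obtain ⟨k, rfl⟩ : ∃ k, n = k + 1 := ⟨n - 1, by omega⟩
  have h0 : 0 ≤ orbit q x k := Int.fract_nonneg _
  have h1 : orbit q x k < 1 := Int.fract_lt_one _
  have hq' : (0 : ℝ) < (q (k + 1) : ℝ) := by
    have := hq (k + 1) hn
    exact_mod_cast (by omega : 0 < q (k + 1))
  rw [digit_succ]
  refine ⟨Int.floor_nonneg.2 (by positivity), ?_⟩
  rw [Int.le_sub_one_iff, Int.floor_lt]
  push_cast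
  nlinarith

theorem hasSum_of_bounds {q : ℕ → ℕ} {E : ℕ → ℤ}
    (hE : ∀ n, 1 ≤ n → 0 ≤ E n ∧ E n ≤ (q n : ℤ) - 1) {y : ℝ}
    (h : Tendsto (fun n => ∑ k ∈ Finset.range n,
      (E (k + 1) : ℝ) / (partialProd q (k + 1) : ℝ)) atTop (𝓝 y)) :
    HasSum (fun n : ℕ => (E (n + 1) : ℝ) / (partialProd q (n + 1) : ℝ)) y := by
  refine (hasSum_iff_tendsto_nat_of_nonneg (fun k => ?_) y).2 h
  have : (0 : ℝ) ≤ (E (k + 1) : ℝ) := by exact_mod_cast (hE (k + 1) (by omega)).1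
  positivity

theorem digit_isCantorExpansion (q : ℕ → ℕ) (hq : IsBasicSequence q) (x : ℝ) :
    IsCantorExpansion q x (digit q x) := by
  refine ⟨rfl, digit_bounds q hq x, ?_, ?_⟩
  · intro hev
    have hev' : ∀ᶠ n in atTop, digit q x n = (q n : ℤ) - 1 := by
      filter_upwards [hev] with n hn
      exact not_not.1 hn
    obtain ⟨N, hN⟩ := eventually_atTop.1 hev'
    -- the quantity `(1 - T_n) / (q_1 ... q_n)` is eventually constant, positive, and tends to `0`
    have hstep : ∀ k, (1 - orbit q x (N + k)) / (partialProd q (N + k) : ℝ) =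
        (1 - orbit q x N) / (partialProd q N : ℝ) := by
      intro k
      induction k with
      | zero => rfl
      | succ k ih =>
        rw [← ih, ← add_assoc, orbit_succ, hN (N + k + 1) (by omega)]
        have h1 := partialProd_pos hq (N + k)
        have h2 := partialProd_pos hq (N + k + 1)
        rw [partialProd_succ] at h2 ⊢
        push_cast at h2 ⊢
        have h3 : (q (N + k + 1) : ℝ) ≠ 0 := by
          rintro h
          simp [h] at h2
        field_simp
        ring
    have hpos : 0 < (1 - orbit q x N) / (partialProd q N : ℝ) := by
      have h1 : orbit q x N < 1 := Int.fract_lt_one _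
      exact div_pos (by linarith) (partialProd_pos hq N)
    obtain ⟨k, hk⟩ := ((tendsto_inv_partialProd hq).eventually (gt_mem_nhds hpos)).and
      (eventually_ge_atTop N) |>.exists
    have h4 := hstep (k - N)
    rw [Nat.add_sub_cancel' hk.2] at h4
    have h5 : 0 ≤ orbit q x k := Int.fract_nonneg _
    have h6 : (1 - orbit q x k) / (partialProd q k : ℝ) ≤ 1 / (partialProd q k : ℝ) :=
      div_le_div_of_nonneg_right (by linarith) (partialProd_pos hq k).le
    linarith [hk.1]
  · refine hasSum_of_bounds (digit_bounds q hq x) ?_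
    simp_rw [sum_digit q hq x, digit_zero]
    have h : Tendsto (fun n => orbit q x n / (partialProd q n : ℝ)) atTop (𝓝 0) := by
      refine squeeze_zero (fun n => ?_) (fun n => ?_) (tendsto_inv_partialProd hq)
      · exact div_nonneg (Int.fract_nonneg _) (partialProd_pos hq n).le
      · exact div_le_div_of_nonneg_right (Int.fract_lt_one _).le (partialProd_pos hq n).le
    simpa using h.const_sub (x - ⌊x⌋)

theorem partialSum_integral {q : ℕ → ℕ} (hq : IsBasicSequence q) (E : ℕ → ℤ) (n : ℕ) :
    ∃ z : ℤ, ∑ k ∈ Finset.range n, (E (k + 1) : ℝ) / (partialProd q (k + 1) : ℝ) =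
      (z : ℝ) / (partialProd q n : ℝ) := by
  induction n with
  | zero => exact ⟨0, by simp⟩
  | succ n ih =>
    obtain ⟨z, hz⟩ := ih
    refine ⟨z * q (n + 1) + E (n + 1), ?_⟩
    rw [Finset.sum_range_succ, hz]
    have h1 := partialProd_pos hq n
    have h2 := partialProd_pos hq (n + 1)
    rw [partialProd_succ] at h2 ⊢
    push_cast at h2 ⊢
    have h3 : (q (n + 1) : ℝ) ≠ 0 := by
      rintro h
      simp [h] at h2
    field_simp

theorem IsCantorExpansion.partialSum_bounds {q : ℕ → ℕ} (hq : IsBasicSequence q) {x : ℝ}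
    {E : ℕ → ℤ} (h : IsCantorExpansion q x E) (n : ℕ) :
    ∑ k ∈ Finset.range n, (E (k + 1) : ℝ) / (partialProd q (k + 1) : ℝ) ≤ x - (E 0 : ℝ) ∧
      x - (E 0 : ℝ) < ∑ k ∈ Finset.range n, (E (k + 1) : ℝ) / (partialProd q (k + 1) : ℝ) +
        1 / (partialProd q n : ℝ) := by
  obtain ⟨-, hE, hfreq, hsum⟩ := h
  have hnn : ∀ k : ℕ, 0 ≤ (E (k + 1) : ℝ) / (partialProd q (k + 1) : ℝ) := by
    intro k
    have : (0 : ℝ) ≤ (E (k + 1) : ℝ) := by exact_mod_cast (hE (k + 1) (by omega)).1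
    positivity
  refine ⟨sum_le_hasSum _ (fun k _ => hnn k) hsum, ?_⟩
  set U : ℕ → ℝ := fun n => ∑ k ∈ Finset.range n,
    (E (k + 1) : ℝ) / (partialProd q (k + 1) : ℝ) + 1 / (partialProd q n : ℝ) with hU
  have hdiff : ∀ k, U k - U (k + 1) =
      ((q (k + 1) : ℝ) - 1 - (E (k + 1) : ℝ)) / (partialProd q (k + 1) : ℝ) := by
    intro k
    simp only [hU, Finset.sum_range_succ]
    have h1 := partialProd_pos hq k
    have h2 := partialProd_pos hq (k + 1)
    rw [partialProd_succ] at h2 ⊢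
    push_cast at h2 ⊢
    have h3 : (q (k + 1) : ℝ) ≠ 0 := by
      rintro h
      simp [h] at h2
    field_simp
    ring
  have hanti : Antitone U := by
    refine antitone_nat_of_succ_le (fun k => ?_)
    have h1 : (E (k + 1) : ℝ) ≤ (q (k + 1) : ℝ) - 1 := by
      exact_mod_cast (hE (k + 1) (by omega)).2
    have h2 := div_nonneg (by linarith : 0 ≤ (q (k + 1) : ℝ) - 1 - (E (k + 1) : ℝ))
      (partialProd_pos hq (k + 1)).le
    linarith [hdiff k]
  have hlim : Tendsto U atTop (𝓝 (x - (E 0 : ℝ))) := by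
    have h := hsum.tendsto_sum_nat.add (tendsto_inv_partialProd hq)
    rwa [add_zero] at h
  obtain ⟨j, hj, hne⟩ := frequently_atTop.1 hfreq (n + 1)
  obtain ⟨k, rfl⟩ : ∃ k, j = k + 1 := ⟨j - 1, by omega⟩
  have hlt : (E (k + 1) : ℝ) < (q (k + 1) : ℝ) - 1 := by
    exact_mod_cast lt_of_le_of_ne (hE (k + 1) (by omega)).2 hne
  have h2 := div_pos (by linarith : 0 < (q (k + 1) : ℝ) - 1 - (E (k + 1) : ℝ))
    (partialProd_pos hq (k + 1))
  have h3 := hdiff k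
  have h4 : U k ≤ U n := hanti (by omega)
  have h5 : x - (E 0 : ℝ) ≤ U (k + 1) := hanti.le_of_tendsto hlim (k + 1)
  change x - (E 0 : ℝ) < U n
  linarith

/-- Every real number has exactly one `Q`-Cantor series expansion, and its digits are `digit q x`. -/
theorem isCantorExpansion_iff {q : ℕ → ℕ} (hq : IsBasicSequence q) (x : ℝ) (E : ℕ → ℤ) :
    IsCantorExpansion q x E ↔ E = digit q x := by
  refine ⟨fun hE => ?_, fun h => h ▸ digit_isCantorExpansion q hq x⟩
  have hD := digit_isCantorExpansion q hq x
  have h0 : E 0 = digit q x 0 := hE.1.trans hD.1.symm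
  have hS : ∀ n, ∑ k ∈ Finset.range n, (E (k + 1) : ℝ) / (partialProd q (k + 1) : ℝ) =
      ∑ k ∈ Finset.range n, (digit q x (k + 1) : ℝ) / (partialProd q (k + 1) : ℝ) := by
    intro n
    obtain ⟨a1, a2⟩ := hE.partialSum_bounds hq n
    obtain ⟨b1, b2⟩ := hD.partialSum_bounds hq n
    obtain ⟨z, hz⟩ := partialSum_integral hq E n
    obtain ⟨w, hw⟩ := partialSum_integral hq (digit q x) n
    have hP := partialProd_pos hq n
    rw [← h0] at b1 b2
    rw [hz] at a1 a2 ⊢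
    rw [hw] at b1 b2 ⊢
    rw [← add_div] at a2 b2
    have c1 : (z : ℝ) < w + 1 := (div_lt_div_iff_of_pos_right hP).1 (a1.trans_lt b2)
    have c2 : (w : ℝ) < z + 1 := (div_lt_div_iff_of_pos_right hP).1 (b1.trans_lt a2)
    have d1 : z < w + 1 := by exact_mod_cast c1
    have d2 : w < z + 1 := by exact_mod_cast c2
    rw [show z = w by omega]
  funext n
  cases n with
  | zero => exact h0
  | succ n =>
    have h1 := hS (n + 1)
    rw [Finset.sum_range_succ, Finset.sum_range_succ, hS n, add_right_inj,
      div_left_inj' (partialProd_pos hq (n + 1)).ne'] at h1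
    exact_mod_cast h1

/-- The series in `fractionValue` converges whenever the `Eₙ` are digits. -/
theorem summable_fractionValue {q : ℕ → ℕ} (hq : IsBasicSequence q) {E : ℕ → ℤ}
    (hE : ∀ n, 1 ≤ n → 0 ≤ E n ∧ E n ≤ (q n : ℤ) - 1) :
    Summable (fun n : ℕ => (E (n + 1) : ℝ) / (partialProd q (n + 1) : ℝ)) := by
  have hnn : ∀ k : ℕ, 0 ≤ (E (k + 1) : ℝ) / (partialProd q (k + 1) : ℝ) := by
    intro k
    have : (0 : ℝ) ≤ (E (k + 1) : ℝ) := by exact_mod_cast (hE (k + 1) (by omega)).1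
    positivity
  refine summable_of_sum_range_le (c := 1) hnn (fun n => ?_)
  suffices h : ∑ k ∈ Finset.range n, (E (k + 1) : ℝ) / (partialProd q (k + 1) : ℝ) ≤
      1 - 1 / (partialProd q n : ℝ) by
    have := partialProd_pos hq n
    have h2 : 0 ≤ 1 / (partialProd q n : ℝ) := by positivity
    linarith
  induction n with
  | zero => simp [partialProd_zero]
  | succ n ih =>
    rw [Finset.sum_range_succ]
    have h1 : (E (n + 1) : ℝ) ≤ (q (n + 1) : ℝ) - 1 := by
      exact_mod_cast (hE (n + 1) (by omega)).2
    have h2 := partialProd_pos hq (n + 1)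
    have h3 : (E (n + 1) : ℝ) / (partialProd q (n + 1) : ℝ) ≤
        ((q (n + 1) : ℝ) - 1) / (partialProd q (n + 1) : ℝ) :=
      div_le_div_of_nonneg_right h1 h2.le
    have h4 : ((q (n + 1) : ℝ) - 1) / (partialProd q (n + 1) : ℝ) =
        1 / (partialProd q n : ℝ) - 1 / (partialProd q (n + 1) : ℝ) := by
      have h5 := partialProd_pos hq n
      rw [partialProd_succ] at h2 ⊢
      push_cast at h2 ⊢
      have h6 : (q (n + 1) : ℝ) ≠ 0 := by
        rintro h
        simp [h] at h2
      field_simp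
    linarith

end CantorSeries

namespace CantorSeries

/-! ### Counting and uniform distribution -/

/-! Since `q n → ∞`, the orbit point of index `n` is within `1 / q (n + 1)` of its relative digit `E
(n + 1) / q (n + 1)`. Uniform distribution survives perturbations tending to zero
(`isUniformlyDistributed_of_close`), so every question about orbits becomes one about relative
digits.

Type I and type II normality then agree class by class: the orbit of `x` along a progression and the
orbit of the number built from the digits on that progression have the same leading digits
(`isUniformlyDistributed_ap_iff`).

Normal numbers are already meagre: a generic `x` lies infinitely often so close to the right of some
`k / (q₁ ⋯ qⱼ)` that a long run of orbit points stays below `1 / 2`.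

Centred indicators of distinct digits are orthogonal in `L²[0,1)`, so a strong law gives the
expected frequencies for almost every `x`, even with thresholds varying with the index
(`ae_tendsto_average_digit`). Applied to the even indices, it shows that almost every `x` fails
abnormality, whence measure zero.

For dimension one, let `y` have random digits in base `quarter q` and spread them into base `q`:
over the lower half, the upper half or the whole of the digit range, as prescribed by `sign`. On
ever longer blocks `sign` is `1` along one progression, every progression recurring infinitely
often, which destroys uniform distribution on each of them. Each `1` is compensated by a `-1`, so
`sign` averages to zero and the full orbit is uniformly distributed for almost every `y`. Dividing
the base by about `4` costs nothing in dimension because `q n → ∞`: the inverse of `y ↦ spreadPoint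
q y` is Hölder of every exponent `s < 1` (`abs_sub_le_spreadPoint`), and a set of positive length
has dimension one. -/

theorem countIn_succ (I : Set ℝ) (ω : ℕ → ℝ) (N : ℕ) :
    (countIn I ω (N + 1) : ℝ) = countIn I ω N + I.indicator 1 (ω N) := by
  classical
  unfold countIn
  rw [Finset.range_add_one, Finset.filter_insert]
  by_cases h : ω N ∈ I
  · simp [h]
  · simp [h]

theorem countIn_eq_sum (I : Set ℝ) (ω : ℕ → ℝ) (N : ℕ) :
    (countIn I ω N : ℝ) = ∑ n ∈ Finset.range N, I.indicator 1 (ω n) := by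
  induction N with
  | zero => simp [countIn]
  | succ N ih => rw [countIn_succ, Finset.sum_range_succ, ih]

theorem countIn_le (I : Set ℝ) (ω : ℕ → ℝ) (N : ℕ) : countIn I ω N ≤ N := by
  classical
  unfold countIn
  exact (Finset.card_filter_le _ _).trans (by simp)

theorem countIn_le_add {I J : Set ℝ} {a b : ℕ → ℝ} {n₀ N : ℕ}
    (h : ∀ n, n₀ ≤ n → n < N → a n ∈ I → b n ∈ J) : countIn I a N ≤ countIn J b N + n₀ := by
  classical
  unfold countIn
  calc _ ≤ (((Finset.range N).filter (fun i => b i ∈ J)) ∪ Finset.range n₀).card := by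
        refine Finset.card_le_card (fun i hi => ?_)
        simp only [Finset.mem_filter, Finset.mem_range, Finset.mem_union] at hi ⊢
        by_cases hn : i < n₀
        · exact Or.inr hn
        · exact Or.inl ⟨hi.1, h i (by omega) hi.1 hi.2⟩
    _ ≤ _ := (Finset.card_union_le _ _).trans (by simp)

theorem le_countIn_add {I : Set ℝ} {a : ℕ → ℝ} {n₀ N : ℕ}
    (h : ∀ n, n₀ ≤ n → n < N → a n ∈ I) : N ≤ countIn I a N + n₀ := by
  classical
  have h1 : countIn (Set.univ) a N = N := by simp [countIn]
  have h2 := countIn_le_add (I := Set.univ) (J := I) (a := a) (b := a) (n₀ := n₀) (N := N)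
    (fun n h0 h1 _ => h n h0 h1)
  omega

theorem tendsto_const_div_nat (c : ℝ) : Tendsto (fun N : ℕ => c / (N : ℝ)) atTop (𝓝 0) :=
  tendsto_const_div_atTop_nhds_zero_nat c

/-- Uniform distribution may be tested on rational `t` and is stable under perturbations
that tend to zero. -/
theorem isUniformlyDistributed_of_close {a b : ℕ → ℝ} (ha : ∀ n, 0 ≤ a n ∧ a n < 1)
    (hb : ∀ n, 0 ≤ b n)
    (h : ∀ t : ℚ, 0 ≤ t → t ≤ 1 →
      Tendsto (fun N : ℕ => (countIn (Set.Ico 0 (t : ℝ)) b N : ℝ) / (N : ℝ)) atTop (𝓝 (t : ℝ)))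
    (hab : Tendsto (fun n => a n - b n) atTop (𝓝 0)) : IsUniformlyDistributed a := by
  intro t ht
  rcases eq_or_lt_of_le ht.1 with rfl | h0
  · simp [countIn]
  rcases eq_or_lt_of_le ht.2 with rfl | h1
  · have : ∀ N, countIn (Set.Ico 0 1) a N = N := fun N => by
      have := le_countIn_add (I := Set.Ico 0 1) (a := a) (n₀ := 0) (N := N)
        (fun n _ _ => ⟨(ha n).1, (ha n).2⟩)
      have := countIn_le (Set.Ico 0 1) a N
      omega
    simp_rw [this]
    refine tendsto_const_nhds.congr' ?_
    filter_upwards [eventually_gt_atTop 0] with N hN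
    have : (N : ℝ) ≠ 0 := by positivity
    field_simp
  rw [tendsto_order]
  constructor
  · intro l hl
    -- For a rational `p < t` the gap `t - p` absorbs the perturbation: from some index on, `b n <
    -- p` forces `a n < t`. The upper bound is symmetric, with `p > t`.
    obtain ⟨p, hp1, hp2⟩ := exists_rat_btwn (max_lt hl h0)
    have hp0 : (0 : ℝ) < p := (le_max_right _ _).trans_lt hp1
    have hlp : l < p := (le_max_left _ _).trans_lt hp1
    obtain ⟨n₀, hn₀⟩ := eventually_atTop.1
      (hab.eventually (gt_mem_nhds (show (0 : ℝ) < t - p by linarith)))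
    have hlim := (h p (by exact_mod_cast hp0.le) (by exact_mod_cast (hp2.trans h1).le)).sub
      (tendsto_const_div_nat n₀)
    rw [sub_zero] at hlim
    filter_upwards [hlim.eventually (lt_mem_nhds hlp)] with N hN
    refine hN.trans_le ?_
    rw [← sub_div]
    refine div_le_div_of_nonneg_right ?_ (Nat.cast_nonneg N)
    have := countIn_le_add (I := Set.Ico 0 (p : ℝ)) (J := Set.Ico 0 t) (a := b) (b := a)
      (n₀ := n₀) (N := N) (fun n hn _ hm => ⟨(ha n).1, by linarith [hn₀ n hn, hm.2]⟩)
    have h3 : (countIn (Set.Ico 0 (p : ℝ)) b N : ℝ) ≤ countIn (Set.Ico 0 t) a N + n₀ := by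
      exact_mod_cast this
    linarith
  · intro u hu
    obtain ⟨p, hp1, hp2⟩ := exists_rat_btwn (lt_min hu h1)
    have hp0 : (p : ℝ) < 1 := hp2.trans_le (min_le_right _ _)
    have hlp : (p : ℝ) < u := hp2.trans_le (min_le_left _ _)
    obtain ⟨n₀, hn₀⟩ := eventually_atTop.1
      (hab.eventually (lt_mem_nhds (show t - p < (0 : ℝ) by linarith)))
    have hlim := (h p (by exact_mod_cast (h0.trans hp1).le) (by exact_mod_cast hp0.le)).add
      (tendsto_const_div_nat n₀)
    rw [add_zero] at hlim
    filter_upwards [hlim.eventually (gt_mem_nhds hlp)] with N hN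
    refine lt_of_le_of_lt ?_ hN
    rw [← add_div]
    refine div_le_div_of_nonneg_right ?_ (Nat.cast_nonneg N)
    have := countIn_le_add (I := Set.Ico 0 t) (J := Set.Ico 0 (p : ℝ)) (a := a) (b := b)
      (n₀ := n₀) (N := N) (fun n hn _ hm => ⟨hb n, by linarith [hn₀ n hn, hm.2]⟩)
    exact_mod_cast this

theorem IsUniformlyDistributed.of_tendsto_sub {a b : ℕ → ℝ} (ha : ∀ n, 0 ≤ a n ∧ a n < 1)
    (hb : ∀ n, 0 ≤ b n) (h : IsUniformlyDistributed b)
    (hab : Tendsto (fun n => a n - b n) atTop (𝓝 0)) : IsUniformlyDistributed a :=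
  isUniformlyDistributed_of_close ha hb
    (fun t h0 h1 => h t ⟨by exact_mod_cast h0, by exact_mod_cast h1⟩) hab

theorem not_isUniformlyDistributed_of_frequently {ω : ℕ → ℝ} {t c : ℝ} (ht : t ∈ Set.Icc (0 : ℝ) 1)
    (hc : t < c) (h : ∃ᶠ N : ℕ in atTop, c * N ≤ countIn (Set.Ico 0 t) ω N) :
    ¬ IsUniformlyDistributed ω := by
  intro hu
  refine h ?_
  filter_upwards [(hu t ht).eventually (gt_mem_nhds hc), eventually_gt_atTop 0] with N hN h0
  have : (0 : ℝ) < N := by exact_mod_cast h0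
  rw [div_lt_iff₀ this] at hN
  linarith

theorem not_isUniformlyDistributed_of_eventually_mem {ω : ℕ → ℝ}
    (h : ∀ᶠ n in atTop, ω n ∈ Set.Ico (0 : ℝ) (1 / 2)) : ¬ IsUniformlyDistributed ω := by
  obtain ⟨n₀, hn₀⟩ := eventually_atTop.1 h
  refine not_isUniformlyDistributed_of_frequently (t := 1 / 2) (c := 3 / 4)
    ⟨by norm_num, by norm_num⟩ (by norm_num) (Eventually.frequently ?_)
  filter_upwards [eventually_ge_atTop (4 * n₀)] with N hN
  have := le_countIn_add (I := Set.Ico (0 : ℝ) (1 / 2)) (a := ω) (n₀ := n₀) (N := N)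
    (fun n h0 _ => hn₀ n h0)
  have h1 : (N : ℝ) ≤ countIn (Set.Ico (0 : ℝ) (1 / 2)) ω N + n₀ := by exact_mod_cast this
  have h2 : (4 : ℝ) * n₀ ≤ N := by exact_mod_cast hN
  linarith

theorem not_isUniformlyDistributed_of_eventually_notMem {ω : ℕ → ℝ}
    (h : ∀ᶠ n in atTop, ω n ∉ Set.Ico (0 : ℝ) (1 / 2)) : ¬ IsUniformlyDistributed ω := by
  obtain ⟨n₀, hn₀⟩ := eventually_atTop.1 h
  intro hu
  have h1 : Tendsto (fun N : ℕ => (countIn (Set.Ico (0 : ℝ) (1 / 2)) ω N : ℝ) / (N : ℝ)) atTop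
      (𝓝 0) := by
    refine squeeze_zero (fun N => by positivity) (fun N => ?_) (tendsto_const_div_nat n₀)
    refine div_le_div_of_nonneg_right ?_ (Nat.cast_nonneg N)
    have := countIn_le_add (I := Set.Ico (0 : ℝ) (1 / 2)) (J := ∅) (a := ω) (b := ω) (n₀ := n₀)
      (N := N) (fun n h0 _ h2 => (hn₀ n h0 h2).elim)
    have h3 : countIn ∅ ω N = 0 := by simp [countIn]
    rw [h3, zero_add] at this
    exact_mod_cast this
  have := tendsto_nhds_unique h1 (hu (1 / 2) ⟨by norm_num, by norm_num⟩)
  norm_num at this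

/-! ### Tails of series with admissible digits -/

theorem orbit_nonneg (q : ℕ → ℕ) (x : ℝ) (n : ℕ) : 0 ≤ orbit q x n := Int.fract_nonneg _

theorem orbit_lt_one (q : ℕ → ℕ) (x : ℝ) (n : ℕ) : orbit q x n < 1 := Int.fract_lt_one _

/-- The `n`-th tail `∑_{k > n} E_k / (q_{n+1} ⋯ q_k)`. -/
noncomputable def tail (q : ℕ → ℕ) (E : ℕ → ℤ) (n : ℕ) : ℝ :=
  partialProd q n * (fractionValue q E -
    ∑ k ∈ Finset.range n, (E (k + 1) : ℝ) / (partialProd q (k + 1) : ℝ))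

section tail

variable {q : ℕ → ℕ} {E : ℕ → ℤ}

theorem tail_zero (q : ℕ → ℕ) (E : ℕ → ℤ) : tail q E 0 = fractionValue q E := by
  simp [tail, partialProd_zero]

theorem tail_succ (hq : IsBasicSequence q) (E : ℕ → ℤ) (n : ℕ) :
    (q (n + 1) : ℝ) * tail q E n = E (n + 1) + tail q E (n + 1) := by
  unfold tail
  have h1 := partialProd_pos hq n
  have h2 := partialProd_pos hq (n + 1)
  rw [Finset.sum_range_succ]
  rw [partialProd_succ] at h2 ⊢
  push_cast at h2 ⊢
  have h3 : (q (n + 1) : ℝ) ≠ 0 := by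
    rintro h
    simp [h] at h2
  field_simp
  ring

theorem tail_nonneg (hq : IsBasicSequence q)
    (hE : ∀ n, 1 ≤ n → 0 ≤ E n ∧ E n ≤ (q n : ℤ) - 1) (n : ℕ) : 0 ≤ tail q E n := by
  refine mul_nonneg (partialProd_pos hq n).le (sub_nonneg.2 ?_)
  refine (summable_fractionValue hq hE).sum_le_tsum _ (fun k _ => ?_)
  have : (0 : ℝ) ≤ (E (k + 1) : ℝ) := by exact_mod_cast (hE (k + 1) (by omega)).1
  positivity

theorem tail_le_one (hq : IsBasicSequence q)
    (hE : ∀ n, 1 ≤ n → 0 ≤ E n ∧ E n ≤ (q n : ℤ) - 1) (n : ℕ) : tail q E n ≤ 1 := by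
  have hP := partialProd_pos hq n
  suffices h : fractionValue q E ≤
      ∑ k ∈ Finset.range n, (E (k + 1) : ℝ) / (partialProd q (k + 1) : ℝ) +
        1 / (partialProd q n : ℝ) by
    calc tail q E n ≤ partialProd q n * (1 / (partialProd q n : ℝ)) :=
          mul_le_mul_of_nonneg_left (by linarith) hP.le
      _ = 1 := by field_simp
  refine le_of_tendsto (summable_fractionValue hq hE).hasSum.tendsto_sum_nat ?_
  filter_upwards [eventually_ge_atTop n] with N hN
  -- Partial sums increased by `1 / partialProd q N` decrease in `N`, because each digit is at most
  -- `q - 1`.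
  suffices h : ∑ k ∈ Finset.range N, (E (k + 1) : ℝ) / (partialProd q (k + 1) : ℝ) +
      1 / (partialProd q N : ℝ) ≤
      ∑ k ∈ Finset.range n, (E (k + 1) : ℝ) / (partialProd q (k + 1) : ℝ) +
        1 / (partialProd q n : ℝ) by
    have : 0 ≤ 1 / (partialProd q N : ℝ) := by positivity
    linarith
  induction N, hN using Nat.le_induction with
  | base => exact le_rfl
  | succ N hN ih =>
    refine le_trans ?_ ih
    rw [Finset.sum_range_succ]
    have h1 : (E (N + 1) : ℝ) + 1 ≤ (q (N + 1) : ℝ) := by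
      have := (hE (N + 1) (by omega)).2
      exact_mod_cast (by omega : E (N + 1) + 1 ≤ (q (N + 1) : ℤ))
    have h2 := partialProd_pos hq (N + 1)
    have h3 : (E (N + 1) : ℝ) / (partialProd q (N + 1) : ℝ) + 1 / (partialProd q (N + 1) : ℝ) ≤
        1 / (partialProd q N : ℝ) := by
      have h5 := partialProd_pos hq N
      rw [← add_div, div_le_div_iff₀ h2 h5, partialProd_succ]
      push_cast
      nlinarith
    linarith

theorem fract_tail (hq : IsBasicSequence q) (E : ℕ → ℤ) (n : ℕ) :
    orbit q (fractionValue q E) n = Int.fract (tail q E n) := by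
  obtain ⟨z, hz⟩ := partialSum_integral hq E n
  have hP := partialProd_pos hq n
  unfold orbit tail
  rw [hz, Int.fract_eq_fract]
  refine ⟨z, ?_⟩
  field_simp
  ring

theorem orbit_eq_tail (hq : IsBasicSequence q)
    (hE : ∀ n, 1 ≤ n → 0 ≤ E n ∧ E n ≤ (q n : ℤ) - 1) {n : ℕ} (h : tail q E n < 1) :
    orbit q (fractionValue q E) n = tail q E n := by
  rw [fract_tail hq, Int.fract_eq_self]
  exact ⟨tail_nonneg hq hE n, h⟩

theorem tail_succ_eq_one (hq : IsBasicSequence q)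
    (hE : ∀ n, 1 ≤ n → 0 ≤ E n ∧ E n ≤ (q n : ℤ) - 1) {n : ℕ} (h : tail q E n = 1) :
    tail q E (n + 1) = 1 := by
  have h1 := tail_succ hq E n
  have h2 : (E (n + 1) : ℝ) + 1 ≤ (q (n + 1) : ℝ) := by
    have := (hE (n + 1) (by omega)).2
    exact_mod_cast (by omega : E (n + 1) + 1 ≤ (q (n + 1) : ℤ))
  rw [h] at h1
  have := tail_le_one hq hE (n + 1)
  linarith

end tail

/-! ### The two notions of AP normality -/

theorem tendsto_inv_comp {q : ℕ → ℕ} (hlim : InfiniteInLimit q) {e : ℕ → ℕ}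
    (he : Tendsto e atTop atTop) : Tendsto (fun n => 1 / (q (e n) : ℝ)) atTop (𝓝 0) :=
  tendsto_one_div_atTop_nhds_zero_nat.comp (hlim.comp he)

theorem tendsto_ap {m : ℕ} (hm : 1 ≤ m) (r : ℕ) :
    Tendsto (fun n => m * n + r) atTop atTop :=
  tendsto_atTop_mono (fun n => by nlinarith : ∀ n, n ≤ m * n + r) tendsto_id

/-- Two points with the same leading digit `e` in base `Q` lie in a common interval of length `1 /
Q`. -/
theorem abs_sub_le_inv {Q a b s t e : ℝ} (hQ : 0 < Q) (ha : 0 ≤ a) (ha' : a ≤ 1) (hb : 0 ≤ b)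
    (hb' : b ≤ 1) (hs : Q * s = e + a) (ht : Q * t = e + b) : |s - t| ≤ 1 / Q := by
  have : s - t = (a - b) / Q := by
    field_simp
    linarith
  rw [this, abs_div, abs_of_pos hQ]
  exact div_le_div_of_nonneg_right (abs_le.2 ⟨by linarith, by linarith⟩) hQ.le

/-- Both sequences have leading digit `E_{mn+r+1}` in base `q_{mn+r+1}`, so their difference tends
to zero. The shift to `r + 1` reflects that the orbit point of index `n` is governed by the digit of
index `n + 1`. -/
theorem isUniformlyDistributed_ap_iff {q : ℕ → ℕ} (hq : IsBasicSequence q)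
    (hlim : InfiniteInLimit q) (x : ℝ) {m r : ℕ} (hm : 1 ≤ m) :
    IsUniformlyDistributed (fun n => orbit q x (m * n + r)) ↔
      DistributionNormal (apSubseq m (r + 1) q)
        (fractionValue (apSubseq m (r + 1) q) (apSubseq m (r + 1) (digit q x))) := by
  set q' := apSubseq m (r + 1) q with hq'
  set E := apSubseq m (r + 1) (digit q x) with hEdef
  have hqb : IsBasicSequence q' := fun n _ => hq _ (by omega)
  have hE : ∀ n, 1 ≤ n → 0 ≤ E n ∧ E n ≤ (q' n : ℤ) - 1 :=
    fun n _ => digit_bounds q hq x _ (by omega)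
  have hclose : Tendsto (fun n => orbit q x (m * n + r) - tail q' E n) atTop (𝓝 0) := by
    refine squeeze_zero_norm (fun n => ?_) (tendsto_inv_comp hlim (tendsto_ap hm (r + 1)))
    have hpos : (0 : ℝ) < q (m * n + (r + 1)) := by
      have := hq (m * n + (r + 1)) (by omega)
      exact_mod_cast (by omega : 0 < q (m * n + (r + 1)))
    have h1 := orbit_succ q x (m * n + r)
    have h2 := tail_succ hqb E n
    simp only [hq', hEdef, apSubseq, Nat.add_sub_cancel] at h2
    exact abs_sub_le_inv hpos (orbit_nonneg q x _) (orbit_lt_one q x (m * n + (r + 1))).le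
      (tail_nonneg hqb hE (n + 1)) (tail_le_one hqb hE (n + 1))
      (by rw [← add_assoc]; linarith) h2
  have hx : ∀ n, 0 ≤ orbit q x (m * n + r) ∧ orbit q x (m * n + r) < 1 :=
    fun n => ⟨orbit_nonneg q x _, orbit_lt_one q x _⟩
  -- Digits taken along a progression may be maximal from some place on, although those of `x` are
  -- not. The tail is then `1` while its fractional part is `0`. In that case neither side holds:
  -- the orbit of `x` along the progression tends to `1` and the other orbit is eventually `0`.
  by_cases hone : ∃ n, tail q' E n = 1
  · obtain ⟨n₀, hn₀⟩ := hone
    have hall : ∀ n, n₀ ≤ n → tail q' E n = 1 := fun n hn => by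
      induction n, hn using Nat.le_induction with
      | base => exact hn₀
      | succ n _ ih => exact tail_succ_eq_one hqb hE ih
    refine iff_of_false ?_ ?_
    · refine not_isUniformlyDistributed_of_eventually_notMem ?_
      filter_upwards [eventually_ge_atTop n₀,
        hclose.eventually (lt_mem_nhds (show (-(1 / 2) : ℝ) < 0 by norm_num))] with n hn h1 h2
      rw [hall n hn] at h1
      linarith [h2.2]
    · refine not_isUniformlyDistributed_of_eventually_mem ?_
      filter_upwards [eventually_ge_atTop n₀] with n hn
      rw [fract_tail hqb, hall n hn]
      norm_num
  · push Not at hone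
    have hlt : ∀ n, tail q' E n < 1 := fun n => lt_of_le_of_ne (tail_le_one hqb hE n) (hone n)
    have horb : orbit q' (fractionValue q' E) = tail q' E :=
      funext fun n => orbit_eq_tail hqb hE (hlt n)
    have ht : ∀ n, 0 ≤ tail q' E n := tail_nonneg hqb hE
    unfold DistributionNormal
    rw [horb]
    refine ⟨fun h => h.of_tendsto_sub (fun n => ⟨ht n, hlt n⟩) (fun n => (hx n).1) ?_,
      fun h => h.of_tendsto_sub hx ht hclose⟩
    simpa using hclose.neg

theorem apNormalTypeI_iff_typeII {q : ℕ → ℕ} (hq : IsBasicSequence q) (hlim : InfiniteInLimit q)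
    (x : ℝ) : APNormalTypeI q x ↔ APNormalTypeII q x := by
  constructor
  · intro h m r hr hrm
    obtain ⟨s, rfl⟩ : ∃ s, r = s + 1 := ⟨r - 1, by omega⟩
    exact (isUniformlyDistributed_ap_iff hq hlim x (by omega)).1 (h m s (by omega))
  · intro h m r hrm
    exact (isUniformlyDistributed_ap_iff hq hlim x (by omega)).2 (h m (r + 1) (by omega) (by omega))

/-! ### Meagreness -/

theorem dvd_partialProd {q : ℕ → ℕ} {i j : ℕ} (h : i ≤ j) : partialProd q i ∣ partialProd q j :=
  Finset.prod_dvd_prod_of_subset _ _ _ (Finset.Icc_subset_Icc_right h)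

/-- As `partialProd q n` divides `partialProd q j`, multiplying by the latter sends `k / partialProd
q n` to an integer. The orbit point is therefore the magnified distance from `x` to that fraction,
which is still below `1 / 2` at index `M`. -/
theorem orbit_lt_half {q : ℕ → ℕ} (hq : IsBasicSequence q) {n j M : ℕ} (hnj : n ≤ j) (hjM : j ≤ M)
    {k : ℤ} {x : ℝ} (h1 : (k : ℝ) / partialProd q n < x)
    (h2 : x < k / partialProd q n + 1 / (2 * partialProd q M)) : orbit q x j < 1 / 2 := by
  have hn := partialProd_pos hq n
  have hj := partialProd_pos hq j
  have hM := partialProd_pos hq M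
  obtain ⟨c, hc⟩ := dvd_partialProd (q := q) hnj
  have hjM' : (partialProd q j : ℝ) ≤ partialProd q M := by
    have := dvd_partialProd (q := q) hjM
    exact_mod_cast Nat.le_of_dvd (by exact_mod_cast hM) this
  have hkey : orbit q x j = partialProd q j * (x - k / partialProd q n) := by
    unfold orbit
    rw [Int.fract_eq_iff]
    refine ⟨by positivity [sub_pos.2 h1], ?_, c * k, ?_⟩
    · calc (partialProd q j : ℝ) * (x - k / partialProd q n)
          < partialProd q j * (1 / (2 * partialProd q M)) :=
            mul_lt_mul_of_pos_left (by linarith) hj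
        _ ≤ partialProd q M * (1 / (2 * partialProd q M)) := by gcongr
        _ < 1 := by
          field_simp
          norm_num
    · rw [hc]
      push_cast
      field_simp
      ring
  rw [hkey]
  calc (partialProd q j : ℝ) * (x - k / partialProd q n)
      < partialProd q j * (1 / (2 * partialProd q M)) :=
        mul_lt_mul_of_pos_left (by linarith) hj
    _ ≤ partialProd q M * (1 / (2 * partialProd q M)) := by gcongr
    _ = 1 / 2 := by field_simp

theorem isMeagre_distributionNormal {q : ℕ → ℕ} (hq : IsBasicSequence q) :
    IsMeagre {x : ℝ | DistributionNormal q x} := by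
  -- For `x` in such an interval the orbit points of indices `j` to `4 * j` are below `1 / 2`. These
  -- are `3 * j + 1` of the first `4 * j + 1`, a proportion above `3 / 4`.
  set U : ℕ → Set ℝ := fun n => ⋃ j ≥ n, ⋃ k : ℤ, Set.Ioo ((k : ℝ) / partialProd q j)
    (k / partialProd q j + 1 / (2 * partialProd q (4 * j + 1))) with hU
  have hopen : ∀ n, IsOpen (U n) := fun n =>
    isOpen_biUnion fun j _ => isOpen_iUnion fun k => isOpen_Ioo
  have hdense : ∀ n, Dense (U n) := by
    intro n
    rw [dense_iff_inter_open]
    rintro V hV ⟨x, hx⟩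
    obtain ⟨ε, hε, hball⟩ := Metric.isOpen_iff.1 hV x hx
    obtain ⟨j, hj, hjn⟩ := (((tendsto_inv_partialProd hq).eventually
      (gt_mem_nhds (half_pos hε))).and (eventually_ge_atTop n)).exists
    have hP := partialProd_pos hq j
    have hP' := partialProd_pos hq (4 * j + 1)
    have hle : (partialProd q j : ℝ) ≤ partialProd q (4 * j + 1) := by
      have := dvd_partialProd (q := q) (show j ≤ 4 * j + 1 by omega)
      exact_mod_cast Nat.le_of_dvd (by exact_mod_cast hP') this
    set k := ⌊(partialProd q j : ℝ) * x⌋ with hk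
    have hk1 : (k : ℝ) ≤ partialProd q j * x := Int.floor_le _
    have hk2 : partialProd q j * x < k + 1 := Int.lt_floor_add_one _
    have hk1' : (k : ℝ) / partialProd q j ≤ x := by
      rw [div_le_iff₀ hP]
      linarith
    have hk2' : x < (k : ℝ) / partialProd q j + 1 / partialProd q j := by
      rw [← add_div, lt_div_iff₀ hP]
      linarith
    have hd : 0 < 1 / (4 * (partialProd q (4 * j + 1) : ℝ)) := by positivity
    have hd1 : 1 / (4 * (partialProd q (4 * j + 1) : ℝ)) < 1 / (2 * partialProd q (4 * j + 1)) :=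
      one_div_lt_one_div_of_lt (by positivity) (by linarith)
    have hd2 : 1 / (4 * (partialProd q (4 * j + 1) : ℝ)) ≤ 1 / partialProd q j :=
      one_div_le_one_div_of_le (by positivity) (by linarith)
    refine ⟨k / partialProd q j + 1 / (4 * partialProd q (4 * j + 1)), hball ?_, ?_⟩
    · rw [Metric.mem_ball, Real.dist_eq, abs_lt]
      constructor <;> linarith
    · simp only [hU, Set.mem_iUnion]
      exact ⟨j, hjn, k, by linarith, by linarith⟩
  have hres : (⋂ n, U n) ∈ residual ℝ :=
    residual_of_dense_Gδ (IsGδ.iInter_of_isOpen hopen)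
      (dense_iInter_of_isOpen hopen hdense)
  refine mem_of_superset hres (fun x hx => ?_)
  rw [Set.mem_compl_iff, Set.mem_ofPred_eq]
  refine not_isUniformlyDistributed_of_frequently (t := 1 / 2) (c := 3 / 4)
    ⟨by norm_num, by norm_num⟩ (by norm_num) ?_
  rw [frequently_atTop]
  intro n
  have hxn := Set.mem_iInter.1 hx n
  simp only [hU, Set.mem_iUnion] at hxn
  obtain ⟨j, hjn, k, h1, h2⟩ := hxn
  refine ⟨4 * j + 1, by omega, ?_⟩
  have := le_countIn_add (I := Set.Ico (0 : ℝ) (1 / 2)) (a := orbit q x) (n₀ := j)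
    (N := 4 * j + 1) (fun i hi hi' => ⟨orbit_nonneg q x i, orbit_lt_half hq hi (by omega) h1 h2⟩)
  have h3 : ((4 * j + 1 : ℕ) : ℝ) ≤
      countIn (Set.Ico (0 : ℝ) (1 / 2)) (orbit q x) (4 * j + 1) + j := by exact_mod_cast this
  push_cast at h3 ⊢
  linarith

/-! ### A strong law for bounded orthogonal functions -/

section StrongLaw

variable {Ω : Type*} [MeasurableSpace Ω] {μ : Measure Ω} [IsProbabilityMeasure μ]
  {f : ℕ → Ω → ℝ}

theorem integrable_mul_of_bounded (hm : ∀ n, Measurable (f n)) (hb : ∀ n x, |f n x| ≤ 1)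
    (i j : ℕ) : Integrable (fun x => f i x * f j x) μ := by
  refine Integrable.of_bound ((hm i).mul (hm j)).aestronglyMeasurable 1 (ae_of_all _ fun x => ?_)
  rw [Real.norm_eq_abs, abs_mul]
  exact mul_le_one₀ (hb i x) (abs_nonneg _) (hb j x)

theorem integral_sq_sum_le (hm : ∀ n, Measurable (f n)) (hb : ∀ n x, |f n x| ≤ 1)
    (ho : ∀ i j, i < j → ∫ x, f i x * f j x ∂μ = 0) (N : ℕ) :
    ∫ x, (∑ n ∈ Finset.range N, f n x) ^ 2 ∂μ ≤ N := by
  have hint := integrable_mul_of_bounded (μ := μ) hm hb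
  have ho' : ∀ i j, i ≠ j → ∫ x, f i x * f j x ∂μ = 0 := by
    intro i j hij
    rcases lt_or_gt_of_ne hij with h | h
    · exact ho i j h
    · simp_rw [mul_comm (f i _)]
      exact ho j i h
  simp_rw [sq, Finset.sum_mul_sum]
  rw [integral_finsetSum _ fun i _ => integrable_finsetSum _ fun j _ => hint i j]
  calc ∑ i ∈ Finset.range N, ∫ x, ∑ j ∈ Finset.range N, f i x * f j x ∂μ
      ≤ ∑ i ∈ Finset.range N, (1 : ℝ) := by
        refine Finset.sum_le_sum fun i hi => ?_
        rw [integral_finsetSum _ fun j _ => hint i j, Finset.sum_eq_single_of_mem i hi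
          fun j _ hj => ho' i j hj.symm]
        calc ∫ x, f i x * f i x ∂μ ≤ ∫ _, (1 : ℝ) ∂μ := by
              refine integral_mono (hint i i) (integrable_const _) fun x => ?_
              have := abs_le.1 (hb i x)
              simp only
              nlinarith
          _ = 1 := by simp
    _ = N := by simp

/-- By orthogonality the average over the first `k ^ 2` terms has second moment at most `1 / k ^ 2`,
which is summable, so these averages tend to zero almost everywhere. Between consecutive squares the
sum moves by at most `2 * k`, negligible against `k ^ 2`. -/
theorem ae_tendsto_average_of_orthogonal (hm : ∀ n, Measurable (f n)) (hb : ∀ n x, |f n x| ≤ 1)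
    (ho : ∀ i j, i < j → ∫ x, f i x * f j x ∂μ = 0) :
    ∀ᵐ x ∂μ, Tendsto (fun N : ℕ => (∑ n ∈ Finset.range N, f n x) / (N : ℝ)) atTop (𝓝 0) := by
  set S : ℕ → Ω → ℝ := fun N x => ∑ n ∈ Finset.range N, f n x with hS
  have hSm : ∀ N, Measurable (S N) := fun N => Finset.measurable_sum _ fun n _ => hm n
  have hSb : ∀ N x, |S N x| ≤ N := fun N x =>
    (Finset.abs_sum_le_sum_abs _ _).trans ((Finset.sum_le_sum fun n _ => hb n x).trans (by simp))
  have hlin : ∀ k : ℕ, ∫⁻ x, ENNReal.ofReal ((S ((k + 1) ^ 2) x / ((k : ℝ) + 1) ^ 2) ^ 2) ∂μ ≤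
      ENNReal.ofReal (1 / ((k : ℝ) + 1) ^ 2) := by
    intro k
    have hk : (0 : ℝ) < ((k : ℝ) + 1) ^ 2 := by positivity
    rw [← ofReal_integral_eq_lintegral_ofReal _ (ae_of_all _ fun x => sq_nonneg _)]
    · refine ENNReal.ofReal_le_ofReal ?_
      simp_rw [div_pow]
      rw [integral_div, div_le_div_iff₀ (by positivity) hk]
      have := integral_sq_sum_le (μ := μ) hm hb ho ((k + 1) ^ 2)
      push_cast at this
      rw [sq (((k : ℝ) + 1) ^ 2), one_mul]
      exact mul_le_mul_of_nonneg_right this hk.le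
    · refine Integrable.of_bound (((hSm _).div_const _).pow_const 2).aestronglyMeasurable 1
        (ae_of_all _ fun x => ?_)
      have h1 : |S ((k + 1) ^ 2) x / ((k : ℝ) + 1) ^ 2| ≤ 1 := by
        rw [abs_div, abs_of_pos hk, div_le_one hk]
        exact_mod_cast hSb ((k + 1) ^ 2) x
      rw [norm_pow, Real.norm_eq_abs]
      exact pow_le_one₀ (abs_nonneg _) h1
  have hsum : ∫⁻ x, ∑' k : ℕ,
      ENNReal.ofReal ((S ((k + 1) ^ 2) x / ((k : ℝ) + 1) ^ 2) ^ 2) ∂μ ≠ ⊤ := by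
    rw [lintegral_tsum fun k =>
      (((hSm _).div_const _).pow_const 2).ennreal_ofReal.aemeasurable]
    refine ne_top_of_le_ne_top ?_ (ENNReal.tsum_le_tsum hlin)
    have hs : Summable (fun k : ℕ => 1 / ((k : ℝ) + 1) ^ 2) := by
      have := (summable_nat_add_iff 1).2 (Real.summable_one_div_nat_pow.2 one_lt_two)
      simpa using this
    exact hs.tsum_ofReal_ne_top
  have hae := ae_lt_top' (AEMeasurable.tsum fun k =>
      (((hSm _).div_const _).pow_const 2).ennreal_ofReal.aemeasurable) hsum
  filter_upwards [hae] with x hx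
  have h0 := ENNReal.tendsto_atTop_zero_of_tsum_ne_top hx.ne
  have h1 : Tendsto (fun k : ℕ => (S ((k + 1) ^ 2) x / ((k : ℝ) + 1) ^ 2) ^ 2) atTop (𝓝 0) := by
    have := (ENNReal.tendsto_toReal ENNReal.zero_ne_top).comp h0
    simpa [Function.comp_def, ENNReal.toReal_ofReal, sq_nonneg] using this
  have h2 : Tendsto (fun k : ℕ => |S ((k + 1) ^ 2) x / ((k : ℝ) + 1) ^ 2|) atTop (𝓝 0) := by
    have := h1.sqrt
    simpa [Real.sqrt_sq_eq_abs] using this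
  have h3 : Tendsto (fun k : ℕ => |S (k ^ 2) x / (k : ℝ) ^ 2|) atTop (𝓝 0) := by
    rw [← tendsto_add_atTop_iff_nat 1]
    simpa using h2
  have h4 : Tendsto (fun k : ℕ => |S (k ^ 2) x / (k : ℝ) ^ 2| + 2 / (k : ℝ)) atTop (𝓝 0) := by
    simpa using h3.add (tendsto_const_div_nat 2)
  have hsqrt : Tendsto Nat.sqrt atTop atTop := by
    refine tendsto_atTop.2 fun b => ?_
    filter_upwards [eventually_ge_atTop (b * b)] with N hN
    exact Nat.le_sqrt.2 hN
  refine squeeze_zero_norm' ?_ (h4.comp hsqrt)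
  filter_upwards [eventually_ge_atTop 1] with N hN
  set k := Nat.sqrt N with hk
  have hk1 : k ^ 2 ≤ N := Nat.sqrt_le' N
  have hk2 : N ≤ k ^ 2 + 2 * k := by
    have := Nat.sqrt_le_add N
    nlinarith
  have hkpos : 0 < k := Nat.sqrt_pos.2 hN
  have hkR : (0 : ℝ) < k := by exact_mod_cast hkpos
  have hdiff : |S N x - S (k ^ 2) x| ≤ 2 * k := by
    have : S N x - S (k ^ 2) x = ∑ n ∈ Finset.Ico (k ^ 2) N, f n x := by
      rw [Finset.sum_Ico_eq_sub _ hk1]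
    rw [this]
    refine (Finset.abs_sum_le_sum_abs _ _).trans ((Finset.sum_le_sum fun n _ => hb n x).trans ?_)
    simp only [Finset.sum_const, Nat.card_Ico, nsmul_eq_mul, mul_one]
    exact_mod_cast (by omega : N - k ^ 2 ≤ 2 * k)
  have hNk : ((k : ℝ)) ^ 2 ≤ N := by exact_mod_cast hk1
  have hk2pos : (0 : ℝ) < (k : ℝ) ^ 2 := by positivity
  change |S N x / N| ≤ |S (k ^ 2) x / (k : ℝ) ^ 2| + 2 / (k : ℝ)
  rw [abs_div, abs_div, abs_of_pos hk2pos, abs_of_pos (hk2pos.trans_le hNk)]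
  calc |S N x| / (N : ℝ) ≤ |S N x| / (k : ℝ) ^ 2 :=
        div_le_div_of_nonneg_left (abs_nonneg _) hk2pos hNk
    _ ≤ (|S (k ^ 2) x| + 2 * k) / (k : ℝ) ^ 2 := by
        refine div_le_div_of_nonneg_right ?_ hk2pos.le
        have := abs_sub_abs_le_abs_sub (S N x) (S (k ^ 2) x)
        linarith
    _ = _ := by
        field_simp

end StrongLaw

/-! ### Averages of digits -/

/-- On each interval of length `1 / P` the floor is constant while the fractional part sweeps
`[0,1)` once, so every piece contributes a multiple of `∫ B = 0`. This is the source of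
orthogonality. -/
theorem intervalIntegral_floor_mul_fract (A : ℤ → ℝ) {B : ℝ → ℝ} (hB : Measurable B)
    (hBb : ∀ u, |B u| ≤ 1) (h0 : ∫ u in (0 : ℝ)..1, B u = 0) {P : ℕ} (hP : 0 < P) :
    ∫ x in (0 : ℝ)..1, A ⌊(P : ℝ) * x⌋ * B (Int.fract ((P : ℝ) * x)) = 0 := by
  have hPR : (P : ℝ) ≠ 0 := by positivity
  have hBi : ∀ a b : ℝ, IntervalIntegrable B volume a b := fun a b =>
    (intervalIntegrable_const (c := (1 : ℝ))).mono_fun hB.aestronglyMeasurable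
      (ae_of_all _ fun u => by simpa using hBb u)
  rw [intervalIntegral.integral_comp_mul_left (fun u => A ⌊u⌋ * B (Int.fract u)) hPR]
  have hpiece : ∀ k : ℕ, Set.EqOn (fun u => A k * B (u - k)) (fun u => A ⌊u⌋ * B (Int.fract u))
      (Set.Ioo ((k : ℕ) : ℝ) ((k + 1 : ℕ) : ℝ)) := by
    intro k u hu
    have h1 : ⌊u⌋ = (k : ℤ) := by
      rw [Int.floor_eq_iff]
      have := hu.2
      push_cast at this ⊢
      exact ⟨hu.1.le, this⟩
    simp only [Int.fract, h1, Int.cast_natCast]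
  have hshift : ∀ k : ℕ, IntervalIntegrable (fun u => A k * B (u - k)) volume
      ((k : ℕ) : ℝ) ((k + 1 : ℕ) : ℝ) := fun k => by
    refine IntervalIntegrable.const_mul ?_ _
    exact (intervalIntegrable_const (c := (1 : ℝ))).mono_fun
      (hB.comp (measurable_id.sub_const (k : ℝ))).aestronglyMeasurable
      (ae_of_all _ fun u => by simpa using hBb (u - k))
  have hle : ∀ k : ℕ, ((k : ℕ) : ℝ) ≤ ((k + 1 : ℕ) : ℝ) := fun k => by push_cast; linarith
  have hsum := intervalIntegral.sum_integral_adjacent_intervals (μ := volume)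
    (f := fun u => A ⌊u⌋ * B (Int.fract u)) (a := fun k : ℕ => (k : ℝ)) (n := P)
    (fun k _ => (hshift k).congr_uIoo (by
      rw [Set.uIoo_of_le (hle k)]
      exact hpiece k))
  rw [mul_zero, mul_one]
  simp only [Nat.cast_zero] at hsum
  rw [← hsum, Finset.sum_eq_zero, smul_zero]
  intro k _
  rw [← intervalIntegral.integral_congr_Ioo_of_le (hle k) (hpiece k),
    intervalIntegral.integral_const_mul, intervalIntegral.integral_comp_sub_right B]
  push_cast
  rw [sub_self, add_sub_cancel_left, h0, mul_zero]

/-- The floor at level `j` determines every earlier floor, hence every digit up to index `j`. Here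
and in the lemmas on digit averages, bases equal to `1` are allowed, because `quarter q` may contain
them. -/
theorem floor_partialProd_eq {q : ℕ → ℕ} (hq : ∀ n, 1 ≤ n → 1 ≤ q n) {i j : ℕ} (h : i ≤ j)
    (x : ℝ) : ⌊(partialProd q i : ℝ) * x⌋ =
      ⌊(partialProd q j : ℝ) * x⌋ / ((partialProd q j / partialProd q i : ℕ) : ℤ) := by
  have hpos : ∀ n, 0 < partialProd q n := fun n =>
    Finset.prod_pos fun k hk => hq k (Finset.mem_Icc.1 hk).1
  obtain ⟨c, hc⟩ := dvd_partialProd (q := q) h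
  have hc0 : 0 < c := by
    rcases Nat.eq_zero_or_pos c with rfl | h0
    · have := hpos j
      simp [hc] at this
    · exact h0
  have hcR : (c : ℝ) ≠ 0 := by positivity
  rw [hc, Nat.mul_div_cancel_left _ (hpos i), ← Int.floor_div_natCast]
  push_cast
  congr 1
  field_simp

theorem digit_succ_eq (q : ℕ → ℕ) (x : ℝ) (n : ℕ) :
    digit q x (n + 1) = ⌊(partialProd q (n + 1) : ℝ) * x⌋ -
      q (n + 1) * ⌊(partialProd q n : ℝ) * x⌋ := by
  rw [digit_succ, orbit, Int.fract, ← Int.floor_sub_intCast]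
  congr 1
  rw [partialProd_succ]
  push_cast
  ring

theorem measurable_orbit (q : ℕ → ℕ) (n : ℕ) : Measurable (fun x => orbit q x n) :=
  measurable_fract.comp (measurable_const.mul measurable_id)

theorem digit_nonneg (q : ℕ → ℕ) (x : ℝ) (n : ℕ) : 0 ≤ digit q x (n + 1) := by
  rw [digit_succ]
  exact Int.floor_nonneg.2 (mul_nonneg (Nat.cast_nonneg _) (orbit_nonneg q x n))

theorem digit_lt {q : ℕ → ℕ} (hq : ∀ n, 1 ≤ n → 1 ≤ q n) (x : ℝ) (n : ℕ) :
    digit q x (n + 1) < q (n + 1) := by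
  rw [digit_succ, Int.floor_lt]
  have : (1 : ℝ) ≤ q (n + 1) := by exact_mod_cast hq (n + 1) (by omega)
  push_cast
  nlinarith [orbit_lt_one q x n]

/-- The centred indicator of `digit < c`, as a function of the preceding orbit point. -/
noncomputable def centredIndicator (Q c : ℕ) (u : ℝ) : ℝ :=
  (Set.Iio ((c : ℝ) / Q)).indicator 1 u - (c : ℝ) / Q

theorem measurable_centredIndicator (Q c : ℕ) : Measurable (centredIndicator Q c) :=
  (measurable_one.indicator measurableSet_Iio).sub_const _

theorem abs_centredIndicator_le {Q c : ℕ} (h : c ≤ Q) (u : ℝ) :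
    |centredIndicator Q c u| ≤ 1 := by
  have h0 : 0 ≤ (c : ℝ) / Q := by positivity
  have h1 : (c : ℝ) / Q ≤ 1 := div_le_one_of_le₀ (by exact_mod_cast h) (Nat.cast_nonneg _)
  unfold centredIndicator
  rw [abs_le]
  by_cases hu : u ∈ Set.Iio ((c : ℝ) / Q)
  · simp only [hu, Set.indicator_of_mem, Pi.one_apply]
    constructor <;> linarith
  · simp only [hu, not_false_eq_true, Set.indicator_of_notMem]
    constructor <;> linarith

theorem integral_centredIndicator {Q c : ℕ} (h : c ≤ Q) :
    ∫ u in (0 : ℝ)..1, centredIndicator Q c u = 0 := by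
  have h0 : 0 ≤ (c : ℝ) / Q := by positivity
  have h1 : (c : ℝ) / Q ≤ 1 := div_le_one_of_le₀ (by exact_mod_cast h) (Nat.cast_nonneg _)
  rw [intervalIntegral.integral_of_le zero_le_one, ← integral_Ico_eq_integral_Ioc]
  unfold centredIndicator
  rw [integral_sub, integral_indicator_one measurableSet_Iio, measureReal_restrict_apply
    measurableSet_Iio]
  · have : Set.Iio ((c : ℝ) / Q) ∩ Set.Ico 0 1 = Set.Ico 0 ((c : ℝ) / Q) := by
      ext u
      simp only [Set.mem_inter_iff, Set.mem_Iio, Set.mem_Ico]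
      constructor
      · rintro ⟨h2, h3, -⟩
        exact ⟨h3, h2⟩
      · rintro ⟨h2, h3⟩
        exact ⟨h3, h2, h3.trans_le h1⟩
    simp [this, h0]
  · exact (integrable_const (1 : ℝ)).indicator measurableSet_Iio
  · exact integrable_const _

theorem centredIndicator_eq {Q c : ℕ} (hQ : 0 < Q) (u : ℝ) :
    centredIndicator Q c u = (if ⌊(Q : ℝ) * u⌋ < c then 1 else 0) - (c : ℝ) / Q := by
  have hQR : (0 : ℝ) < Q := by exact_mod_cast hQ
  unfold centredIndicator
  congr 1
  rw [Set.indicator_apply]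
  refine if_congr ?_ rfl rfl
  rw [Set.mem_Iio, lt_div_iff₀ hQR, Int.floor_lt, mul_comm]
  simp

theorem ae_tendsto_average_centredIndicator {q : ℕ → ℕ} (hq : ∀ n, 1 ≤ n → 1 ≤ q n) {c : ℕ → ℕ}
    (hc : ∀ n, c n ≤ q (n + 1)) :
    ∀ᵐ x ∂volume.restrict (Set.Ico (0 : ℝ) 1), Tendsto (fun N : ℕ =>
      (∑ n ∈ Finset.range N, centredIndicator (q (n + 1)) (c n) (orbit q x n)) / (N : ℝ))
      atTop (𝓝 0) := by
  have : IsProbabilityMeasure (volume.restrict (Set.Ico (0 : ℝ) 1)) := ⟨by simp⟩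
  refine ae_tendsto_average_of_orthogonal
    (fun n => (measurable_centredIndicator _ _).comp (measurable_orbit q n))
    (fun n x => abs_centredIndicator_le (hc n) _) (fun i j hij => ?_)
  rw [integral_Ico_eq_integral_Ioc, ← intervalIntegral.integral_of_le zero_le_one]
  -- The earlier factor, rewritten as a function of `⌊partialProd q j * x⌋`; the later one depends
  -- only on the fractional part of `partialProd q j * x`.
  set A : ℤ → ℝ := fun k => (if k / ((partialProd q j / partialProd q (i + 1) : ℕ) : ℤ) -
    q (i + 1) * (k / ((partialProd q j / partialProd q i : ℕ) : ℤ)) < c i then 1 else 0) -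
    (c i : ℝ) / q (i + 1) with hA
  have hpos : 0 < partialProd q j := Finset.prod_pos fun k hk => hq k (Finset.mem_Icc.1 hk).1
  refine Eq.trans ?_ (intervalIntegral_floor_mul_fract A
    (measurable_centredIndicator (q (j + 1)) (c j)) (abs_centredIndicator_le (hc j))
    (integral_centredIndicator (hc j)) hpos)
  congr 1
  funext x
  simp only [hA]
  rw [centredIndicator_eq (hq (i + 1) (by omega)), ← digit_succ, digit_succ_eq,
    floor_partialProd_eq hq (show i + 1 ≤ j by omega),
    floor_partialProd_eq hq (show i ≤ j by omega), orbit]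

theorem tendsto_average_of_tendsto_zero {u : ℕ → ℝ} (hu : Tendsto u atTop (𝓝 0)) :
    Tendsto (fun N : ℕ => (∑ n ∈ Finset.range N, u n) / (N : ℝ)) atTop (𝓝 0) := by
  simpa [div_eq_inv_mul] using hu.cesaro

/-- For almost every `x`, the digits of `x` fall below any prescribed thresholds with the
expected frequency. -/
theorem ae_tendsto_average_digit {q : ℕ → ℕ} (hq : ∀ n, 1 ≤ n → 1 ≤ q n)
    (hlim : InfiniteInLimit q) {θ : ℕ → ℝ} (hθ : ∀ n, θ n ∈ Set.Icc (0 : ℝ) 1) :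
    ∀ᵐ x ∂volume.restrict (Set.Ico (0 : ℝ) 1), Tendsto (fun N : ℕ =>
      (∑ n ∈ Finset.range N, ((Set.Iio (θ n)).indicator 1 ((digit q x (n + 1) : ℝ) / q (n + 1)) -
        θ n)) / (N : ℝ)) atTop (𝓝 0) := by
  -- Rounding up leaves the event unchanged, since digits are integers. It makes the mean exactly `c
  -- n / q (n + 1)`, which differs from `θ n` by at most `1 / q (n + 1)`.
  set c : ℕ → ℕ := fun n => ⌈θ n * q (n + 1)⌉₊ with hcdef
  have hc : ∀ n, c n ≤ q (n + 1) := fun n => by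
    refine Nat.ceil_le.2 ?_
    have : (0 : ℝ) ≤ q (n + 1) := Nat.cast_nonneg _
    nlinarith [(hθ n).2]
  have hQ : ∀ n, (0 : ℝ) < q (n + 1) := fun n => by exact_mod_cast hq (n + 1) (by omega)
  have hu : Tendsto (fun n => (c n : ℝ) / q (n + 1) - θ n) atTop (𝓝 0) := by
    refine squeeze_zero (fun n => ?_) (fun n => ?_) (tendsto_inv_comp hlim (tendsto_add_atTop_nat 1))
    · rw [sub_nonneg, le_div_iff₀ (hQ n)]
      exact Nat.le_ceil _
    · rw [sub_le_iff_le_add, div_add' _ _ _ (hQ n).ne', div_le_div_iff_of_pos_right (hQ n)]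
      have := Nat.ceil_lt_add_one (mul_nonneg (hθ n).1 (hQ n).le)
      linarith
  filter_upwards [ae_tendsto_average_centredIndicator hq hc] with x hx
  have := hx.add (tendsto_average_of_tendsto_zero hu)
  rw [add_zero] at this
  refine this.congr fun N => ?_
  rw [← add_div, ← Finset.sum_add_distrib]
  congr 1
  refine Finset.sum_congr rfl fun n _ => ?_
  rw [centredIndicator_eq (hq (n + 1) (by omega)), ← digit_succ, Set.indicator_apply]
  have : (digit q x (n + 1) : ℝ) / q (n + 1) ∈ Set.Iio (θ n) ↔ digit q x (n + 1) < c n := by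
    rw [Set.mem_Iio, div_lt_iff₀ (hQ n), hcdef]
    obtain ⟨d, hd⟩ := Int.eq_ofNat_of_zero_le (digit_nonneg q x n)
    rw [hd]
    simp [Nat.lt_ceil]
  simp only [this, Pi.one_apply]
  ring

/-! ### Measure zero -/

theorem countIn_Ico_eq_sum {b : ℕ → ℝ} (hb : ∀ n, 0 ≤ b n) (t : ℝ) (N : ℕ) :
    (countIn (Set.Ico 0 t) b N : ℝ) =
      ∑ n ∈ Finset.range N, (Set.Iio t).indicator 1 (b n) := by
  rw [countIn_eq_sum]
  refine Finset.sum_congr rfl fun n _ => ?_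
  simp only [Set.indicator_apply, Set.mem_Ico, Set.mem_Iio, hb n, true_and]

theorem tendsto_average_of_sub {u v : ℕ → ℝ} {l : ℝ}
    (h : Tendsto (fun N : ℕ => (∑ n ∈ Finset.range N, (u n - v n)) / (N : ℝ)) atTop (𝓝 0))
    (hv : Tendsto (fun N : ℕ => (∑ n ∈ Finset.range N, v n) / (N : ℝ)) atTop (𝓝 l)) :
    Tendsto (fun N : ℕ => (∑ n ∈ Finset.range N, u n) / (N : ℝ)) atTop (𝓝 l) := by
  have := h.add hv
  rw [zero_add] at this
  refine this.congr fun N => ?_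
  rw [← add_div, ← Finset.sum_add_distrib]
  simp

theorem tendsto_average_const (c : ℝ) :
    Tendsto (fun N : ℕ => (∑ _n ∈ Finset.range N, c) / (N : ℝ)) atTop (𝓝 c) := by
  refine tendsto_const_nhds.congr' ?_
  filter_upwards [eventually_gt_atTop 0] with N hN
  have : (N : ℝ) ≠ 0 := by positivity
  simp only [Finset.sum_const, Finset.card_range, nsmul_eq_mul]
  field_simp

theorem ae_rat_tendsto_average_digit {q : ℕ → ℕ} (hq : ∀ n, 1 ≤ n → 1 ≤ q n)
    (hlim : InfiniteInLimit q) {θ : ℝ → ℕ → ℝ}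
    (hθ : ∀ t ∈ Set.Icc (0 : ℝ) 1, ∀ n, θ t n ∈ Set.Icc (0 : ℝ) 1) :
    ∀ᵐ x ∂volume.restrict (Set.Ico (0 : ℝ) 1), ∀ t : ℚ, 0 ≤ t → t ≤ 1 → Tendsto (fun N : ℕ =>
      (∑ n ∈ Finset.range N, ((Set.Iio (θ t n)).indicator 1
        ((digit q x (n + 1) : ℝ) / q (n + 1)) - θ t n)) / (N : ℝ)) atTop (𝓝 0) := by
  rw [ae_all_iff]
  intro t
  by_cases h : 0 ≤ t ∧ t ≤ 1
  · filter_upwards [ae_tendsto_average_digit hq hlim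
      (hθ t ⟨by exact_mod_cast h.1, by exact_mod_cast h.2⟩)] with x hx _ _ using hx
  · exact ae_of_all _ fun x h0 h1 => (h ⟨h0, h1⟩).elim

theorem orbit_sub_digit {q : ℕ → ℕ} (hq : IsBasicSequence q) (x : ℝ) (n : ℕ) :
    |orbit q x n - (digit q x (n + 1) : ℝ) / q (n + 1)| ≤ 1 / q (n + 1) := by
  have hQ : (0 : ℝ) < q (n + 1) := by
    have := hq (n + 1) (by omega)
    exact_mod_cast (by omega : 0 < q (n + 1))
  refine abs_sub_le_inv (e := digit q x (n + 1)) hQ (orbit_nonneg q x (n + 1)) (orbit_lt_one q x (n + 1)).le le_rfl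
    zero_le_one (by linarith [orbit_succ q x n]) ?_
  rw [mul_div_cancel₀ _ hQ.ne', add_zero]

theorem ae_isUniformlyDistributed_even {q : ℕ → ℕ} (hq : IsBasicSequence q)
    (hlim : InfiniteInLimit q) :
    ∀ᵐ x ∂volume.restrict (Set.Ico (0 : ℝ) 1),
      IsUniformlyDistributed (fun n => orbit q x (2 * n + 0)) := by
  have hq1 : ∀ n, 1 ≤ n → 1 ≤ q n := fun n hn => one_le_two.trans (hq n hn)
  -- Threshold `0` at odd indices makes those terms vanish, so an average over `2 * N` indices sees
  -- only the even ones.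
  have hθ : ∀ t ∈ Set.Icc (0 : ℝ) 1, ∀ n : ℕ, (if n % 2 = 0 then t else 0) ∈ Set.Icc (0 : ℝ) 1 := by
    intro t ht n
    split_ifs
    · exact ht
    · simp
  filter_upwards [ae_rat_tendsto_average_digit hq1 hlim
    (θ := fun t n => if n % 2 = 0 then t else 0) hθ] with x hx
  have hnn : ∀ n, (0 : ℝ) ≤ (digit q x (n + 1) : ℝ) / q (n + 1) := fun n =>
    div_nonneg (by exact_mod_cast digit_nonneg q x n) (Nat.cast_nonneg _)
  refine isUniformlyDistributed_of_close
    (b := fun n => (digit q x (2 * n + 1) : ℝ) / q (2 * n + 1))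
    (fun n => ⟨orbit_nonneg q x _, orbit_lt_one q x _⟩) (fun n => hnn _) (fun t h0 h1 => ?_) ?_
  · simp_rw [countIn_Ico_eq_sum (fun n => hnn (2 * n))]
    refine tendsto_average_of_sub ?_ (tendsto_average_const (t : ℝ))
    have h2 : Tendsto (fun N : ℕ => 2 * N) atTop atTop :=
      tendsto_atTop_mono (fun N => by simp only [id]; omega) tendsto_id
    have h3 := ((hx t h0 h1).comp h2).const_mul 2
    rw [mul_zero] at h3
    refine h3.congr fun N => ?_
    have hsum : ∑ n ∈ Finset.range (2 * N), ((Set.Iio (if n % 2 = 0 then (t : ℝ) else 0)).indicator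
        1 ((digit q x (n + 1) : ℝ) / q (n + 1)) - (if n % 2 = 0 then (t : ℝ) else 0)) =
        ∑ n ∈ Finset.range N, ((Set.Iio (t : ℝ)).indicator 1
          ((digit q x (2 * n + 1) : ℝ) / q (2 * n + 1)) - (t : ℝ)) := by
      induction N with
      | zero => simp
      | succ N ih =>
        rw [show 2 * (N + 1) = 2 * N + 1 + 1 by ring, Finset.sum_range_succ,
          Finset.sum_range_succ, ih, Finset.sum_range_succ _ N]
        have e1 : 2 * N % 2 = 0 := by omega
        have e2 : ¬ (2 * N + 1) % 2 = 0 := by omega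
        have e3 : (digit q x (2 * N + 1 + 1) : ℝ) / q (2 * N + 1 + 1) ∉ Set.Iio (0 : ℝ) := by
          simpa using hnn (2 * N + 1)
        rw [if_pos e1, if_neg e2, Set.indicator_of_notMem e3]
        ring
    simp only [Function.comp_apply]
    rw [hsum]
    push_cast
    rw [← mul_div_assoc, mul_div_mul_left _ _ two_ne_zero]
  · refine squeeze_zero_norm (fun n => ?_)
      (tendsto_inv_comp hlim (tendsto_ap (m := 2) (by norm_num) 1))
    exact orbit_sub_digit hq x (2 * n)

theorem orbit_add_int (q : ℕ → ℕ) (x : ℝ) (k : ℤ) : orbit q (x + k) = orbit q x := by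
  funext n
  unfold orbit
  rw [Int.fract_eq_fract]
  refine ⟨partialProd q n * k, ?_⟩
  push_cast
  ring

theorem volume_normalAbnormalSet {q : ℕ → ℕ} (hq : IsBasicSequence q)
    (hlim : InfiniteInLimit q) : volume (normalAbnormalSet q) = 0 := by
  have h01 : volume (normalAbnormalSet q ∩ Set.Ico 0 1) = 0 := by
    have h := ae_isUniformlyDistributed_even hq hlim
    rw [ae_restrict_iff' measurableSet_Ico] at h
    refine measure_mono_null (fun x hx => ?_) (ae_iff.1 h)
    intro hc
    exact hx.1.2 2 0 (by norm_num) (by norm_num) (hc hx.2)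
  refine measure_mono_null (t := ⋃ k : ℤ, (fun x : ℝ => x + k) ⁻¹'
    (normalAbnormalSet q ∩ Set.Ico 0 1)) (fun x hx => ?_) (measure_iUnion_null fun k => ?_)
  · refine Set.mem_iUnion.2 ⟨-⌊x⌋, ?_, ?_⟩
    · unfold normalAbnormalSet DistributionNormal APAbnormal at hx ⊢
      simp only [Set.mem_ofPred_eq, orbit_add_int] at hx ⊢
      exact hx
    · simp only [Int.cast_neg]
      rw [← sub_eq_add_neg]
      exact ⟨Int.fract_nonneg x, Int.fract_lt_one x⟩
  · rw [measure_preimage_add_right]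
    exact h01

/-! ### A balanced sequence of signs that is constant on progressions over long blocks -/

/-- `n` lies in the residue class encoded by `k`. -/
def InClass (k n : ℕ) : Prop :=
  n % ((Nat.unpair (Nat.unpair k).1).1 + 2) = (Nat.unpair (Nat.unpair k).1).2

instance (k n : ℕ) : Decidable (InClass k n) := by unfold InClass; infer_instance

/-- On the block `16 ^ k ≤ n < 16 ^ (k + 1)`: `1` on the residue class encoded by `k`, and `-1` on
its successor. -/
def sign (n : ℕ) : ℤ :=
  if InClass (Nat.log 16 n) n then 1
  else if 0 < n ∧ InClass (Nat.log 16 n) (n - 1) then -1 else 0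

theorem not_inClass_succ {k n : ℕ} (h : InClass k n) : ¬ InClass k (n + 1) := by
  unfold InClass at *
  set m := (Nat.unpair (Nat.unpair k).1).1 + 2 with hm
  intro h2
  have h3 : (n + 1) % m = n % m := h2.trans h.symm
  have h4 : (n + 1) ≡ n + 0 [MOD m] := h3
  have h5 := Nat.ModEq.add_left_cancel' n h4
  have h6 : m ∣ 1 := (Nat.modEq_zero_iff_dvd).1 h5
  have := Nat.le_of_dvd one_pos h6
  omega

theorem sign_succ (n : ℕ) : sign (n + 1) =
    (if InClass (Nat.log 16 (n + 1)) (n + 1) then 1 else 0) -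
      (if InClass (Nat.log 16 (n + 1)) n then 1 else 0) := by
  unfold sign
  simp only [Nat.succ_pos, true_and, Nat.add_sub_cancel]
  by_cases h : InClass (Nat.log 16 (n + 1)) n
  · simp [h, not_inClass_succ h]
  · simp [h]

/-- Inside a block each `1` is followed at once by a `-1`, so the sum minus the indicator of a
pending `1` is constant. Passing to the next block changes it by at most `1`. -/
theorem abs_sum_sign_sub_le (N : ℕ) : |∑ n ∈ Finset.range (N + 1), sign n -
    (if InClass (Nat.log 16 N) N then 1 else 0)| ≤ (Nat.log 16 N : ℤ) := by
  induction N with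
  | zero => simp [sign]
  | succ N ih =>
    have hmono : Nat.log 16 N ≤ Nat.log 16 (N + 1) := Nat.log_mono_right (by omega)
    rw [Finset.sum_range_succ, sign_succ]
    rcases eq_or_lt_of_le hmono with h | h
    · rw [← h]
      convert ih using 2
      ring
    · rw [abs_le] at ih ⊢
      split_ifs at ih ⊢ <;> omega

theorem abs_sum_sign_le (N : ℕ) : |∑ n ∈ Finset.range N, sign n| ≤ (Nat.log 16 N : ℤ) + 1 := by
  rcases N with _ | N
  · simp
  · have h := abs_sum_sign_sub_le N
    have hmono : Nat.log 16 N ≤ Nat.log 16 (N + 1) := Nat.log_mono_right (by omega)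
    rw [abs_le] at h ⊢
    split_ifs at h <;> omega

theorem tendsto_average_sign :
    Tendsto (fun N : ℕ => (∑ n ∈ Finset.range N, (sign n : ℝ)) / (N : ℝ)) atTop (𝓝 0) := by
  have hlim : Tendsto (fun N : ℕ => (Real.log N) / N + 1 / (N : ℝ)) atTop (𝓝 0) := by
    have h1 : Tendsto (fun x : ℝ => Real.log x / x) atTop (𝓝 0) :=
      Real.isLittleO_log_id_atTop.tendsto_div_nhds_zero
    simpa using (h1.comp tendsto_natCast_atTop_atTop).add (tendsto_const_div_nat 1)
  refine squeeze_zero_norm' ?_ hlim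
  filter_upwards [eventually_ge_atTop 1] with N hN
  have hNR : (0 : ℝ) < N := by exact_mod_cast hN
  rw [Real.norm_eq_abs, abs_div, abs_of_pos hNR, ← add_div]
  refine div_le_div_of_nonneg_right ?_ hNR.le
  have h1 : |∑ n ∈ Finset.range N, (sign n : ℝ)| ≤ (Nat.log 16 N : ℝ) + 1 := by
    exact_mod_cast abs_sum_sign_le N
  have h2 : (Nat.log 16 N : ℝ) ≤ Real.log N := by
    have h3 : ((16 ^ Nat.log 16 N : ℕ) : ℝ) ≤ N := by
      exact_mod_cast Nat.pow_log_le_self 16 (by omega)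
    have h4 := Real.log_le_log (by positivity) h3
    push_cast at h4
    rw [Real.log_pow] at h4
    have h5 : 1 ≤ Real.log 16 := by
      rw [Real.le_log_iff_exp_le (by norm_num)]
      linarith [Real.exp_one_lt_d9]
    nlinarith [(Nat.cast_nonneg (Nat.log 16 N) : (0 : ℝ) ≤ _)]
  linarith

/-- The coordinate `j` is free and serves only to make every progression reappear on arbitrarily
late blocks. -/
theorem sign_eq_one {m r j k n : ℕ} (hm : 1 < m) (hk : k = Nat.pair (Nat.pair (m - 2) r) j)
    (hn : n % m = r) (h1 : 16 ^ k ≤ n) (h2 : n < 16 ^ (k + 1)) : sign n = 1 := by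
  have hlog : Nat.log 16 n = k := Nat.log_eq_of_pow_le_of_lt_pow h1 h2
  unfold sign
  rw [hlog, if_pos]
  unfold InClass
  rw [hk]
  simp only [Nat.unpair_pair]
  rwa [Nat.sub_add_cancel hm]

theorem sign_cases (n : ℕ) : sign n = 1 ∨ sign n = -1 ∨ sign n = 0 := by
  unfold sign
  split_ifs <;> simp

/-! ### Spreading digits -/

/-- A quarter of `q`, kept positive. -/
def quarter (q : ℕ → ℕ) (n : ℕ) : ℕ := max 1 (q n / 4)

/-- Digits `D < quarter q` spread over the lower half, the upper half or all of `{0, …, q - 1}`,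
according to `sign`. -/
def spread (q : ℕ → ℕ) (D : ℕ → ℤ) : ℕ → ℤ
  | 0 => 0
  | n + 1 => if sign n = 1 then 2 * D (n + 1)
      else if sign n = -1 then q (n + 1) - 2 * quarter q (n + 1) + 2 * D (n + 1)
      else 4 * D (n + 1)

/-- The point whose `Q`-digits are the spread digits of `y`. -/
noncomputable def spreadPoint (q : ℕ → ℕ) (y : ℝ) : ℝ :=
  fractionValue q (spread q (digit (quarter q) y))

theorem one_le_quarter (q : ℕ → ℕ) (n : ℕ) : 1 ≤ quarter q n := le_max_left _ _

theorem infiniteInLimit_quarter {q : ℕ → ℕ} (hlim : InfiniteInLimit q) :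
    InfiniteInLimit (quarter q) := by
  refine tendsto_atTop.2 fun b => ?_
  filter_upwards [hlim.eventually_ge_atTop (4 * b)] with n hn
  unfold quarter
  omega

section spread

variable {q : ℕ → ℕ}

theorem spread_succ (q : ℕ → ℕ) (D : ℕ → ℤ) (n : ℕ) :
    spread q D (n + 1) = if sign n = 1 then 2 * D (n + 1)
      else if sign n = -1 then q (n + 1) - 2 * quarter q (n + 1) + 2 * D (n + 1)
      else 4 * D (n + 1) := rfl

/-- The bound `q - 2`, rather than `q - 1`, keeps every tail strictly below `1`, so that orbit
points of `spreadPoint q y` equal tails. -/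
theorem spread_bounds (hq : IsBasicSequence q) (y : ℝ) (n : ℕ) :
    0 ≤ spread q (digit (quarter q) y) (n + 1) ∧
      spread q (digit (quarter q) y) (n + 1) ≤ (q (n + 1) : ℤ) - 2 := by
  have h1 := digit_nonneg (quarter q) y n
  have h2 := digit_lt (fun n _ => one_le_quarter q n) y n
  have h3 := hq (n + 1) (by omega)
  have h4 : quarter q (n + 1) = 1 ∨ 4 * quarter q (n + 1) ≤ q (n + 1) := by
    unfold quarter
    omega
  rw [spread_succ]
  split_ifs <;> omega

theorem spread_admissible (hq : IsBasicSequence q) (y : ℝ) (n : ℕ) (hn : 1 ≤ n) :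
    0 ≤ spread q (digit (quarter q) y) n ∧
      spread q (digit (quarter q) y) n ≤ (q n : ℤ) - 1 := by
  obtain ⟨k, rfl⟩ : ∃ k, n = k + 1 := ⟨n - 1, by omega⟩
  have := spread_bounds hq y k
  omega

theorem orbit_spreadPoint (hq : IsBasicSequence q) (y : ℝ) (n : ℕ) :
    orbit q (spreadPoint q y) n = tail q (spread q (digit (quarter q) y)) n := by
  have hE := spread_admissible hq y
  refine orbit_eq_tail hq hE ?_
  have h1 := tail_succ hq (spread q (digit (quarter q) y)) n
  have h2 := tail_le_one hq hE (n + 1)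
  have h3 : (spread q (digit (quarter q) y) (n + 1) : ℝ) ≤ (q (n + 1) : ℝ) - 2 := by
    exact_mod_cast (spread_bounds hq y n).2
  have h4 : (0 : ℝ) < q (n + 1) := by
    have := hq (n + 1) (by omega)
    exact_mod_cast (by omega : 0 < q (n + 1))
  by_contra h
  push Not at h
  nlinarith

/-- The limiting position of the `n`-th orbit point of `spreadPoint q y`. -/
noncomputable def spreadPosition (n : ℕ) (v : ℝ) : ℝ :=
  if sign n = 1 then v / 2 else if sign n = -1 then (1 + v) / 2 else v

theorem spreadPosition_nonneg (n : ℕ) {v : ℝ} (hv : 0 ≤ v) : 0 ≤ spreadPosition n v := by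
  unfold spreadPosition
  split_ifs <;> linarith

/-- The relative digit of `y`. -/
noncomputable def relDigit (q : ℕ → ℕ) (y : ℝ) (n : ℕ) : ℝ :=
  (digit (quarter q) y (n + 1) : ℝ) / quarter q (n + 1)

theorem relDigit_nonneg (q : ℕ → ℕ) (y : ℝ) (n : ℕ) : 0 ≤ relDigit q y n :=
  div_nonneg (by exact_mod_cast digit_nonneg _ y n) (Nat.cast_nonneg _)

theorem relDigit_lt_one (q : ℕ → ℕ) (y : ℝ) (n : ℕ) : relDigit q y n < 1 := by
  have h : (0 : ℝ) < quarter q (n + 1) := by exact_mod_cast one_le_quarter q (n + 1)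
  unfold relDigit
  rw [div_lt_one h]
  exact_mod_cast digit_lt (fun n _ => one_le_quarter q n) y n

theorem abs_spread_sub_le {n : ℕ} (h4 : 4 ≤ q (n + 1)) (y : ℝ) :
    |(spread q (digit (quarter q) y) (n + 1) : ℝ) / q (n + 1) -
      spreadPosition n (relDigit q y n)| ≤ 3 / q (n + 1) := by
  have hv0 := relDigit_nonneg q y n
  have hv1 := relDigit_lt_one q y n
  have hM : (0 : ℝ) < quarter q (n + 1) := by exact_mod_cast one_le_quarter q (n + 1)
  have hQ : (0 : ℝ) < q (n + 1) := by exact_mod_cast (by omega : 0 < q (n + 1))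
  have hD : (digit (quarter q) y (n + 1) : ℝ) = relDigit q y n * quarter q (n + 1) := by
    unfold relDigit
    field_simp
  -- The only error is the remainder `ρ` of `q (n + 1)` modulo `4`; for `q (n + 1) ≥ 4` the
  -- truncation at `1` in `quarter` is inactive.
  obtain ⟨ρ, hρ, hρ3⟩ : ∃ ρ : ℕ, q (n + 1) = 4 * quarter q (n + 1) + ρ ∧ ρ ≤ 3 := by
    refine ⟨q (n + 1) - 4 * quarter q (n + 1), ?_, ?_⟩ <;> unfold quarter <;> omega
  have hρR : (q (n + 1) : ℝ) = 4 * quarter q (n + 1) + ρ := by exact_mod_cast hρ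
  have hρ0 : (0 : ℝ) ≤ ρ := Nat.cast_nonneg _
  have hρ3R : (ρ : ℝ) ≤ 3 := by exact_mod_cast hρ3
  have key : ∀ (e z w : ℝ), e - q (n + 1) * z = w → |w| ≤ 3 →
      |e / q (n + 1) - z| ≤ 3 / q (n + 1) := by
    intro e z w h1 h2
    have : e / q (n + 1) - z = w / q (n + 1) := by
      rw [← h1]
      field_simp
    rw [this, abs_div, abs_of_pos hQ]
    exact div_le_div_of_nonneg_right h2 hQ.le
  set v := relDigit q y n
  have hvρ : 0 ≤ v * ρ := mul_nonneg hv0 hρ0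
  have hvρ3 : v * ρ ≤ 3 := by nlinarith
  rw [spread_succ]
  unfold spreadPosition
  split_ifs
  · refine key _ _ (-(v * ρ / 2)) ?_ (abs_le.2 ⟨by linarith, by linarith⟩)
    push_cast
    rw [hD, hρR]
    ring
  · refine key _ _ ((1 - v) * ρ / 2) ?_ (abs_le.2 ⟨by nlinarith, by nlinarith⟩)
    push_cast
    rw [hD, hρR]
    ring
  · refine key _ _ (-(v * ρ)) ?_ (abs_le.2 ⟨by linarith, by linarith⟩)
    push_cast
    rw [hD, hρR]
    ring

theorem tendsto_orbit_spreadPoint_sub (hq : IsBasicSequence q) (hlim : InfiniteInLimit q) (y : ℝ) :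
    Tendsto (fun n => orbit q (spreadPoint q y) n - spreadPosition n (relDigit q y n)) atTop
      (𝓝 0) := by
  have h0 : Tendsto (fun n => 4 * (1 / (q (n + 1) : ℝ))) atTop (𝓝 0) := by
    simpa using (tendsto_inv_comp hlim (tendsto_add_atTop_nat 1)).const_mul 4
  refine squeeze_zero_norm' ?_ h0
  have h4 := (hlim.comp (tendsto_add_atTop_nat 1)).eventually_ge_atTop 4
  filter_upwards [h4] with n hn
  have hE := spread_admissible hq y
  have hQ : (0 : ℝ) < q (n + 1) := by
    have := hq (n + 1) (by omega)
    exact_mod_cast (by omega : 0 < q (n + 1))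
  have h1 := abs_spread_sub_le hn y
  have h2 : |orbit q (spreadPoint q y) n -
      (spread q (digit (quarter q) y) (n + 1) : ℝ) / q (n + 1)| ≤ 1 / q (n + 1) := by
    rw [orbit_spreadPoint hq]
    refine abs_sub_le_inv (e := spread q (digit (quarter q) y) (n + 1)) hQ
      (tail_nonneg hq hE (n + 1)) (tail_le_one hq hE (n + 1)) le_rfl
      zero_le_one (tail_succ hq _ n) ?_
    rw [mul_div_cancel₀ _ hQ.ne', add_zero]
  rw [Real.norm_eq_abs]
  calc _ ≤ _ := abs_sub_le _ _ _
    _ ≤ _ := add_le_add h2 h1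
    _ = _ := by ring

/-- For a uniform `v`, the chance of landing below `t` is `t` shifted by plus, minus or zero times
the same quantity `min t (1 - t)`. The lower-half and upper-half choices thus cancel exactly, and a
zero average of `sign` restores `t`. -/
theorem spreadPosition_lt_iff {n : ℕ} {t v : ℝ} (hv0 : 0 ≤ v) (hv1 : v < 1) :
    spreadPosition n v < t ↔ v < t + sign n * min t (1 - t) := by
  unfold spreadPosition
  rcases le_total t (1 - t) with h | h <;> rcases sign_cases n with hs | hs | hs <;>
    simp only [hs, h, min_eq_left, min_eq_right] <;> norm_num <;> constructor <;> intro h' <;>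
    linarith

theorem ae_distributionNormal_spreadPoint (hq : IsBasicSequence q) (hlim : InfiniteInLimit q) :
    ∀ᵐ y ∂volume.restrict (Set.Ico (0 : ℝ) 1), DistributionNormal q (spreadPoint q y) := by
  have hθ : ∀ t ∈ Set.Icc (0 : ℝ) 1, ∀ n : ℕ,
      t + sign n * min t (1 - t) ∈ Set.Icc (0 : ℝ) 1 := by
    intro t ht n
    have h1 : min t (1 - t) ≤ t := min_le_left _ _
    have h2 : min t (1 - t) ≤ 1 - t := min_le_right _ _
    have h3 : 0 ≤ min t (1 - t) := le_min ht.1 (by linarith [ht.2])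
    rcases sign_cases n with hs | hs | hs <;> rw [hs] <;> push_cast <;>
      constructor <;> linarith [ht.1, ht.2]
  filter_upwards [ae_rat_tendsto_average_digit (fun n _ => one_le_quarter q n)
    (infiniteInLimit_quarter hlim) hθ] with y hy
  refine isUniformlyDistributed_of_close (fun n => ⟨orbit_nonneg q _ _, orbit_lt_one q _ _⟩)
    (fun n => spreadPosition_nonneg n (relDigit_nonneg q y n)) (fun t h0 h1 => ?_)
    (tendsto_orbit_spreadPoint_sub hq hlim y)
  simp_rw [countIn_Ico_eq_sum (fun n => spreadPosition_nonneg n (relDigit_nonneg q y n))]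
  refine tendsto_average_of_sub (v := fun n => (t : ℝ) + sign n * min (t : ℝ) (1 - t)) ?_ ?_
  · refine (hy t h0 h1).congr fun N => ?_
    congr 1
    refine Finset.sum_congr rfl fun n _ => ?_
    congr 1
    simp only [Set.indicator_apply, Set.mem_Iio]
    exact (if_congr (spreadPosition_lt_iff (relDigit_nonneg q y n) (relDigit_lt_one q y n))
      rfl rfl).symm
  · have := (tendsto_average_const (t : ℝ)).add
      (tendsto_average_sign.mul_const (min (t : ℝ) (1 - t)))
    rw [zero_mul, add_zero] at this
    refine this.congr fun N => ?_
    rw [Finset.sum_add_distrib, ← Finset.sum_mul]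
    ring

/-- On a block with `sign = 1` along the progression, its orbit points are below `1 / 2` up to an
error under `1 / 4`. A block ends `16` times further out than it starts, so at its end at least `7 /
8` of the points lie in `[0, 3 / 4)`. -/
theorem apAbnormal_spreadPoint (hq : IsBasicSequence q) (hlim : InfiniteInLimit q) (y : ℝ) :
    APAbnormal q (spreadPoint q y) := by
  intro m r hm hr
  refine not_isUniformlyDistributed_of_frequently (t := 3 / 4) (c := 7 / 8)
    ⟨by norm_num, by norm_num⟩ (by norm_num) ?_
  obtain ⟨n₁, hn₁⟩ := eventually_atTop.1 ((tendsto_orbit_spreadPoint_sub hq hlim y).eventually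
    (gt_mem_nhds (show (0 : ℝ) < 1 / 4 by norm_num)))
  rw [frequently_atTop]
  intro b
  -- Since `j ≤ k < 16 ^ k`, the block starts beyond `n₁`; the summands `b` and `m` give `b + 1 ≤ a
  -- / m`, which yields both `b ≤ N` and `8 * N₀ ≤ N`.
  set j := b + n₁ + m with hj
  set k := Nat.pair (Nat.pair (m - 2) r) j with hk
  have hjk : j ≤ k := Nat.right_le_pair _ _
  set a := 16 ^ k with ha
  have hka : k < a := Nat.lt_pow_self (by norm_num)
  set N := 16 * a / m with hN
  set N₀ := a / m + 1 with hN₀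
  have hNa : 16 * (a / m) ≤ N := by
    rw [hN, Nat.le_div_iff_mul_le (by omega)]
    nlinarith [Nat.div_mul_le_self a m]
  have hkm : (b + 1) * m ≤ a := by
    calc (b + 1) * m ≤ 2 ^ b * 2 ^ m :=
          Nat.mul_le_mul Nat.lt_two_pow_self Nat.lt_two_pow_self.le
      _ = 2 ^ (b + m) := by rw [pow_add]
      _ ≤ 16 ^ (b + m) := Nat.pow_le_pow_left (by norm_num) _
      _ ≤ a := Nat.pow_le_pow_right (by norm_num) (by omega)
  have hbm : b + 1 ≤ a / m := (Nat.le_div_iff_mul_le (by omega)).2 hkm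
  refine ⟨N, by omega, ?_⟩
  have := le_countIn_add (I := Set.Ico (0 : ℝ) (3 / 4))
    (a := fun n => orbit q (spreadPoint q y) (m * n + r)) (n₀ := N₀) (N := N) ?_
  · have h8 : 8 * N₀ ≤ N := by omega
    have h9 : (8 : ℝ) * N₀ ≤ N := by exact_mod_cast h8
    have h10 : (N : ℝ) ≤ countIn (Set.Ico (0 : ℝ) (3 / 4))
      (fun n => orbit q (spreadPoint q y) (m * n + r)) N + N₀ := by exact_mod_cast this
    linarith
  · intro n h1 h2
    refine ⟨orbit_nonneg q _ _, ?_⟩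
    have hlow : a ≤ m * n + r := by
      have h3 : a < m * (a / m + 1) := Nat.lt_mul_div_succ a (by omega)
      have h4 : m * (a / m + 1) ≤ m * n := Nat.mul_le_mul_left m h1
      omega
    have hup : m * n + r < 16 ^ (k + 1) := by
      have h3 : m * (n + 1) ≤ m * N := Nat.mul_le_mul_left m h2
      have h4 : m * N ≤ 16 * a := Nat.mul_div_le _ _
      rw [pow_succ, ← ha]
      nlinarith
    have hs : sign (m * n + r) = 1 := by
      refine sign_eq_one hm hk ?_ hlow hup
      rw [Nat.mul_add_mod, Nat.mod_eq_of_lt hr]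
    have h5 := hn₁ (m * n + r) (by omega)
    have h6 := relDigit_lt_one q y (m * n + r)
    unfold spreadPosition at h5
    rw [if_pos hs] at h5
    linarith

end spread

/-! ### Hausdorff dimension -/

theorem partialProd_mul_sub {q : ℕ → ℕ} {τ τ' : ℕ → ℝ} {E E' : ℕ → ℤ}
    (h : ∀ n, (q (n + 1) : ℝ) * τ n = E (n + 1) + τ (n + 1))
    (h' : ∀ n, (q (n + 1) : ℝ) * τ' n = E' (n + 1) + τ' (n + 1)) {n : ℕ}
    (hE : ∀ k < n, E (k + 1) = E' (k + 1)) :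
    (partialProd q n : ℝ) * (τ' 0 - τ 0) = τ' n - τ n := by
  induction n with
  | zero => simp [partialProd_zero]
  | succ n ih =>
    have h1 := ih fun k hk => hE k (by omega)
    have h2 : (E (n + 1) : ℝ) = E' (n + 1) := by exact_mod_cast hE n (by omega)
    rw [partialProd_succ]
    push_cast
    linear_combination (q (n + 1) : ℝ) * h1 + h' n - h n - h2

/-- Once `q n ^ (1 - s) ≥ 8`, one has `q n ^ s ≤ q n / 8 ≤ quarter q n`, so each further factor
preserves the inequality. The constant `C` absorbs the initial factors. -/
theorem partialProd_rpow_le {q : ℕ → ℕ} (hq : IsBasicSequence q) (hlim : InfiniteInLimit q)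
    {s : ℝ} (hs0 : 0 < s) (hs1 : s < 1) :
    ∃ C : ℝ, 0 < C ∧ ∀ n, (partialProd q n : ℝ) ^ s ≤ C * partialProd (quarter q) n := by
  have h8 : Tendsto (fun n => (q n : ℝ) ^ (1 - s)) atTop atTop :=
    (tendsto_rpow_atTop (by linarith)).comp (tendsto_natCast_atTop_atTop.comp hlim)
  obtain ⟨N, hN⟩ := eventually_atTop.1
    ((h8.eventually_ge_atTop 8).and (hlim.eventually_ge_atTop 4))
  refine ⟨(partialProd q N : ℝ) ^ s, Real.rpow_pos_of_pos (partialProd_pos hq N) s, fun n => ?_⟩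
  have hR : ∀ n, (1 : ℝ) ≤ partialProd (quarter q) n := fun n => by
    have : 0 < partialProd (quarter q) n := Finset.prod_pos fun k _ => one_le_quarter q k
    exact_mod_cast this
  rcases le_total n N with h | h
  · have h1 : (partialProd q n : ℝ) ≤ partialProd q N := by
      exact_mod_cast Nat.le_of_dvd (by exact_mod_cast partialProd_pos hq N) (dvd_partialProd h)
    have h2 := Real.rpow_le_rpow (partialProd_pos hq n).le h1 hs0.le
    have h3 := Real.rpow_nonneg (partialProd_pos hq N).le s
    nlinarith [hR n]
  · induction n, h using Nat.le_induction with
    | base =>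
      have h3 := Real.rpow_nonneg (partialProd_pos hq N).le s
      nlinarith [hR N]
    | succ n hn ih =>
      obtain ⟨h1, h2⟩ := hN (n + 1) (by omega)
      have hQ : (0 : ℝ) < q (n + 1) := by exact_mod_cast (by omega : 0 < q (n + 1))
      have h3 : (q (n + 1) : ℝ) ^ s ≤ quarter q (n + 1) := by
        have h4 : (q (n + 1) : ℝ) ≤ 8 * quarter q (n + 1) := by
          exact_mod_cast (by unfold quarter; omega : q (n + 1) ≤ 8 * quarter q (n + 1))
        have h5 : (q (n + 1) : ℝ) ^ s * (q (n + 1) : ℝ) ^ (1 - s) = q (n + 1) := by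
          rw [← Real.rpow_add hQ]
          simp
        have h6 := Real.rpow_nonneg hQ.le s
        nlinarith
      rw [partialProd_succ, partialProd_succ]
      push_cast
      rw [Real.mul_rpow (Nat.cast_nonneg _) (Nat.cast_nonneg _), ← mul_assoc]
      exact mul_le_mul ih h3 (Real.rpow_nonneg hQ.le s)
        ((Real.rpow_nonneg (partialProd_pos hq n).le s).trans ih)

/-- The left side bounds the distance in `y` and `d / (P * Q)` is a lower bound for the distance in
`spreadPoint`, when the first differing digits are `d` apart. Keeping `d` is essential: the bases
are unbounded, and `d ≤ M` supplies the missing power `1 - s`. -/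
theorem two_mul_div_le_rpow {d M Q P R C s : ℝ} (hs0 : 0 < s) (hs1 : s < 1) (hd : 0 < d)
    (hdM : d ≤ M) (hQ : 0 < Q) (hQM : Q ≤ 8 * M) (hP : 0 < P) (hR : 0 < R) (hPR : P ^ s ≤ C * R) :
    2 * d / (R * M) ≤ 16 * C * (d / (P * Q)) ^ s := by
  have hM : 0 < M := hd.trans_le hdM
  rw [Real.div_rpow hd.le (by positivity), Real.mul_rpow hP.le hQ.le, ← mul_div_assoc,
    div_le_div_iff₀ (by positivity) (by positivity)]
  have h1 : d = d ^ s * d ^ (1 - s) := by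
    rw [← Real.rpow_add hd]
    simp
  have h2 : M = M ^ s * M ^ (1 - s) := by
    rw [← Real.rpow_add hM]
    simp
  have h3 : d ^ (1 - s) ≤ M ^ (1 - s) := Real.rpow_le_rpow hd.le hdM (by linarith)
  have h4 : Q ^ s ≤ 8 * M ^ s := by
    calc Q ^ s ≤ (8 * M) ^ s := Real.rpow_le_rpow hQ.le hQM hs0.le
      _ = 8 ^ s * M ^ s := Real.mul_rpow (by norm_num) hM.le
      _ ≤ 8 ^ (1 : ℝ) * M ^ s := by gcongr; norm_num
      _ = 8 * M ^ s := by rw [Real.rpow_one]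
  have hCR : 0 < C * R := (Real.rpow_pos_of_pos hP s).trans_le hPR
  calc 2 * d * (P ^ s * Q ^ s) = 2 * (d ^ s * d ^ (1 - s)) * (P ^ s * Q ^ s) := by rw [← h1]
    _ ≤ 2 * (d ^ s * M ^ (1 - s)) * (C * R * (8 * M ^ s)) := by gcongr
    _ = 16 * C * d ^ s * (R * (M ^ s * M ^ (1 - s))) := by ring
    _ = 16 * C * d ^ s * (R * M) := by rw [← h2]

theorem two_mul_sub_le_spread_sub {q : ℕ → ℕ} {D D' : ℕ → ℤ} {n : ℕ} (h : D (n + 1) ≤ D' (n + 1)) :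
    2 * (D' (n + 1) - D (n + 1)) ≤ spread q D' (n + 1) - spread q D (n + 1) := by
  rw [spread_succ, spread_succ]
  split_ifs <;> omega

theorem spread_congr {q : ℕ → ℕ} {D D' : ℕ → ℤ} {n : ℕ} (h : D (n + 1) = D' (n + 1)) :
    spread q D (n + 1) = spread q D' (n + 1) := by
  rw [spread_succ, spread_succ, h]

/-- Spreading multiplies digit gaps by at least `2`. A gap `d ≥ 1` thus becomes at least `2 * d`,
and the later digits can remove at most `1`, leaving at least `d`; on the `y` side they add at most
`1`, giving at most `2 * d`. -/
theorem abs_sub_le_spreadPoint_of_digit_lt {q : ℕ → ℕ} (hq : IsBasicSequence q) {s C : ℝ}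
    (hs0 : 0 < s) (hs1 : s < 1)
    (hC : ∀ n, (partialProd q n : ℝ) ^ s ≤ C * partialProd (quarter q) n) {y y' : ℝ}
    (hy : y ∈ Set.Ico (0 : ℝ) 1) (hy' : y' ∈ Set.Ico (0 : ℝ) 1) {n : ℕ}
    (heq : ∀ k < n, digit (quarter q) y (k + 1) = digit (quarter q) y' (k + 1))
    (hlt : digit (quarter q) y (n + 1) < digit (quarter q) y' (n + 1)) :
    |y - y'| ≤ 16 * C * |spreadPoint q y - spreadPoint q y'| ^ s := by
  have horb0 : ∀ z ∈ Set.Ico (0 : ℝ) 1, orbit (quarter q) z 0 = z := fun z hz => by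
    simpa [orbit, partialProd_zero] using Int.fract_eq_self.2 hz
  have hrec : ∀ z n, (quarter q (n + 1) : ℝ) * orbit (quarter q) z n =
      digit (quarter q) z (n + 1) + orbit (quarter q) z (n + 1) := fun z n => by
    linarith [orbit_succ (quarter q) z n]
  have hY := partialProd_mul_sub (hrec y) (hrec y') heq
  rw [horb0 y hy, horb0 y' hy'] at hY
  have hX := partialProd_mul_sub (n := n) (tail_succ hq (spread q (digit (quarter q) y)))
    (tail_succ hq (spread q (digit (quarter q) y'))) (fun k hk => spread_congr (heq k hk))
  rw [tail_zero, tail_zero] at hX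
  change _ * (spreadPoint q y' - spreadPoint q y) = _ at hX
  obtain ⟨d, hd⟩ : ∃ d : ℝ, d =
      ((digit (quarter q) y' (n + 1) - digit (quarter q) y (n + 1) : ℤ) : ℝ) := ⟨_, rfl⟩
  have hd1 : 1 ≤ d := by
    rw [hd]
    exact_mod_cast (by omega :
    1 ≤ digit (quarter q) y' (n + 1) - digit (quarter q) y (n + 1))
  have hdM : d ≤ quarter q (n + 1) := by
    have h1 := digit_lt (fun n _ => one_le_quarter q n) y' n
    have h2 := digit_nonneg (quarter q) y n
    rw [hd]
    exact_mod_cast (by omega :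
      digit (quarter q) y' (n + 1) - digit (quarter q) y (n + 1) ≤ quarter q (n + 1))
  have hE : 2 * d ≤ (spread q (digit (quarter q) y') (n + 1) : ℝ) -
      spread q (digit (quarter q) y) (n + 1) := by
    rw [hd]
    exact_mod_cast two_mul_sub_le_spread_sub (q := q) hlt.le
  push_cast at hd
  have hP := partialProd_pos hq n
  have hR : (0 : ℝ) < partialProd (quarter q) n := by
    have : 0 < partialProd (quarter q) n := Finset.prod_pos fun k _ => one_le_quarter q k
    exact_mod_cast this
  have hQ : (0 : ℝ) < q (n + 1) := by
    have := hq (n + 1) (by omega)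
    exact_mod_cast (by omega : 0 < q (n + 1))
  have hM : (0 : ℝ) < quarter q (n + 1) := by exact_mod_cast one_le_quarter q (n + 1)
  have hQM : (q (n + 1) : ℝ) ≤ 8 * quarter q (n + 1) := by
    exact_mod_cast (by unfold quarter; omega : q (n + 1) ≤ 8 * quarter q (n + 1))
  have hyd : partialProd (quarter q) n * quarter q (n + 1) * (y' - y) =
      d + (orbit (quarter q) y' (n + 1) - orbit (quarter q) y (n + 1)) := by
    linear_combination (quarter q (n + 1) : ℝ) * hY + hrec y' n - hrec y n - hd
  have hxd : d ≤ partialProd q n * q (n + 1) * (spreadPoint q y' - spreadPoint q y) := by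
    have e := tail_succ hq (spread q (digit (quarter q) y)) n
    have e' := tail_succ hq (spread q (digit (quarter q) y')) n
    have l1 := tail_nonneg hq (spread_admissible hq y') (n + 1)
    have l2 := tail_le_one hq (spread_admissible hq y) (n + 1)
    calc d ≤ (q (n + 1) : ℝ) * tail q (spread q (digit (quarter q) y')) n -
          q (n + 1) * tail q (spread q (digit (quarter q) y)) n := by linarith
      _ = _ := by linear_combination -(q (n + 1) : ℝ) * hX
  have o1 := orbit_nonneg (quarter q) y' (n + 1)
  have o2 := orbit_lt_one (quarter q) y' (n + 1)
  have o3 := orbit_nonneg (quarter q) y (n + 1)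
  have o4 := orbit_lt_one (quarter q) y (n + 1)
  have hyabs : |y - y'| ≤ 2 * d / (partialProd (quarter q) n * quarter q (n + 1)) := by
    rw [abs_sub_comm, le_div_iff₀ (by positivity)]
    have h0 : 0 ≤ y' - y := by
      by_contra hneg
      push Not at hneg
      have := mul_neg_of_pos_of_neg (mul_pos hR hM) hneg
      linarith
    rw [abs_of_nonneg h0, mul_comm]
    linarith
  have hxabs : d / (partialProd q n * q (n + 1)) ≤ |spreadPoint q y - spreadPoint q y'| := by
    rw [abs_sub_comm]
    refine le_trans ?_ (le_abs_self _)
    rw [div_le_iff₀ (by positivity), mul_comm]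
    exact hxd
  have hC0 : 0 ≤ C := by
    have h1 := Real.rpow_pos_of_pos hP s
    by_contra hneg
    push Not at hneg
    have := mul_neg_of_neg_of_pos hneg hR
    linarith [hC n]
  calc |y - y'| ≤ _ := hyabs
    _ ≤ 16 * C * (d / (partialProd q n * q (n + 1))) ^ s :=
      two_mul_div_le_rpow hs0 hs1 (by linarith) hdM hQ hQM hP hR (hC n)
    _ ≤ _ := by gcongr

/-- Agreement of all digits would give `partialProd q n * |y' - y| ≤ 1` for every `n`. With bases
`1` permitted, the products are seen to be unbounded from `q n → ∞` instead of from powers of `2`.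
-/
theorem exists_digit_ne {q : ℕ → ℕ} (hlim : InfiniteInLimit q) (hq : ∀ n, 1 ≤ n → 1 ≤ q n)
    {y y' : ℝ} (hy : y ∈ Set.Ico (0 : ℝ) 1) (hy' : y' ∈ Set.Ico (0 : ℝ) 1) (hne : y ≠ y') :
    ∃ n, digit q y (n + 1) ≠ digit q y' (n + 1) := by
  by_contra hall
  push Not at hall
  have horb0 : ∀ z ∈ Set.Ico (0 : ℝ) 1, orbit q z 0 = z := fun z hz => by
    simpa [orbit, partialProd_zero] using Int.fract_eq_self.2 hz
  have hrec : ∀ z n, (q (n + 1) : ℝ) * orbit q z n =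
      digit q z (n + 1) + orbit q z (n + 1) := fun z n => by linarith [orbit_succ q z n]
  have hY : ∀ n, (partialProd q n : ℝ) * |y' - y| ≤ 1 := fun n => by
    have h := partialProd_mul_sub (n := n) (hrec y) (hrec y') fun k _ => hall k
    rw [horb0 y hy, horb0 y' hy'] at h
    have h1 : (partialProd q n : ℝ) * |y' - y| = |orbit q y' n - orbit q y n| := by
      rw [← h, abs_mul, Nat.abs_cast]
    rw [h1, abs_le]
    constructor <;> linarith [orbit_nonneg q y n, orbit_nonneg q y' n, orbit_lt_one q y n,
      orbit_lt_one q y' n]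
  have hpos : 0 < |y' - y| := abs_pos.2 (sub_ne_zero.2 hne.symm)
  obtain ⟨c, hc⟩ := exists_nat_gt (1 / |y' - y|)
  obtain ⟨n, hn⟩ := ((hlim.comp (tendsto_add_atTop_nat 1)).eventually_ge_atTop c).exists
  have h2 : q (n + 1) ≤ partialProd q (n + 1) := by
    rw [partialProd_succ]
    exact Nat.le_mul_of_pos_left _ (Finset.prod_pos fun k hk => hq k (Finset.mem_Icc.1 hk).1)
  have h3 : (c : ℝ) ≤ partialProd q (n + 1) := by exact_mod_cast hn.trans h2
  rw [div_lt_iff₀ hpos] at hc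
  nlinarith [hY (n + 1)]

theorem abs_sub_le_spreadPoint {q : ℕ → ℕ} (hq : IsBasicSequence q) (hlim : InfiniteInLimit q)
    {s : ℝ} (hs0 : 0 < s) (hs1 : s < 1) : ∃ C : ℝ, 0 < C ∧ ∀ y ∈ Set.Ico (0 : ℝ) 1,
      ∀ y' ∈ Set.Ico (0 : ℝ) 1, |y - y'| ≤ C * |spreadPoint q y - spreadPoint q y'| ^ s := by
  obtain ⟨C, hC0, hC⟩ := partialProd_rpow_le hq hlim hs0 hs1
  refine ⟨16 * C, by positivity, fun y hy y' hy' => ?_⟩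
  rcases eq_or_ne y y' with rfl | hne
  · rw [sub_self, abs_zero]
    positivity
  · classical
    have hex := exists_digit_ne (infiniteInLimit_quarter hlim) (fun n _ => one_le_quarter q n)
      hy hy' hne
    have heq : ∀ k < Nat.find hex, digit (quarter q) y (k + 1) = digit (quarter q) y' (k + 1) :=
      fun k hk => not_not.1 (Nat.find_min hex hk)
    rcases lt_or_gt_of_ne (Nat.find_spec hex) with h | h
    · exact abs_sub_le_spreadPoint_of_digit_lt hq hs0 hs1 hC hy hy' heq h
    · rw [abs_sub_comm y, abs_sub_comm (spreadPoint q y)]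
      exact abs_sub_le_spreadPoint_of_digit_lt hq hs0 hs1 hC hy' hy
        (fun k hk => (heq k hk).symm) h

/-- A map on a set of positive length that contracts distances at most to the power `1 / s` has an
image of dimension at least `s`. -/
theorem le_dimH_image_of_antiHolder {Y : Set ℝ} (hY : volume Y ≠ 0) {G : ℝ → ℝ} {s : NNReal}
    (hs : 0 < s) {C : ℝ} (hC : 0 < C)
    (h : ∀ y ∈ Y, ∀ y' ∈ Y, |y - y'| ≤ C * |G y - G y'| ^ (s : ℝ)) :
    (s : ENNReal) ≤ dimH (G '' Y) := by
  have hsR : (0 : ℝ) < s := hs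
  have hinj : Set.InjOn G Y := fun y hy y' hy' he => by
    have := h y hy y' hy'
    rw [he, sub_self, abs_zero, Real.zero_rpow hsR.ne', mul_zero] at this
    exact sub_eq_zero.1 (abs_nonpos_iff.1 this)
  set f := Function.invFunOn G Y with hf
  have hleft : ∀ y ∈ Y, f (G y) = y := hinj.leftInvOn_invFunOn
  have himg : f '' (G '' Y) = Y := by
    rw [Set.image_image]
    exact (Set.image_congr hleft).trans (Set.image_id' Y)
  have hholder : HolderOnWith C.toNNReal s f (G '' Y) := by
    rintro _ ⟨y, hy, rfl⟩ _ ⟨y', hy', rfl⟩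
    rw [hleft y hy, hleft y' hy', edist_dist, edist_dist, Real.dist_eq, Real.dist_eq,
      ENNReal.ofReal_rpow_of_nonneg (abs_nonneg _) hsR.le]
    change _ ≤ ENNReal.ofReal C * _
    rw [← ENNReal.ofReal_mul hC.le]
    exact ENNReal.ofReal_le_ofReal (h y hy y' hy')
  have h1 : (1 : ENNReal) ≤ dimH Y := by
    have : Measure.hausdorffMeasure ((1 : NNReal) : ℝ) Y ≠ 0 := by
      rw [NNReal.coe_one, hausdorffMeasure_real]
      exact hY
    exact_mod_cast le_dimH_of_hausdorffMeasure_ne_zero this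
  have h2 := hholder.dimH_image_le hs
  rw [himg] at h2
  have h3 := (ENNReal.le_div_iff_mul_le (Or.inl (by exact_mod_cast hs.ne'))
    (Or.inl ENNReal.coe_ne_top)).1 (h1.trans h2)
  rwa [one_mul] at h3

theorem dimH_normalAbnormalSet {q : ℕ → ℕ} (hq : IsBasicSequence q) (hlim : InfiniteInLimit q) :
    dimH (normalAbnormalSet q) = 1 := by
  refine le_antisymm ((dimH_mono (Set.subset_univ _)).trans_eq Real.dimH_univ) ?_
  set Y : Set ℝ := {y | y ∈ Set.Ico (0 : ℝ) 1 ∧ DistributionNormal q (spreadPoint q y)} with hYdef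
  have hY : volume Y ≠ 0 := by
    intro h0
    have h := ae_distributionNormal_spreadPoint hq hlim
    rw [ae_restrict_iff' measurableSet_Ico] at h
    have h1 : volume (Set.Ico (0 : ℝ) 1) = 0 := by
      refine measure_mono_null (fun y hy => ?_) (measure_union_null h0 (ae_iff.1 h))
      by_cases hn : DistributionNormal q (spreadPoint q y)
      · exact Or.inl ⟨hy, hn⟩
      · exact Or.inr fun hc => hn (hc hy)
    simp at h1
  have hsub : spreadPoint q '' Y ⊆ normalAbnormalSet q := by
    rintro _ ⟨y, hy, rfl⟩
    exact ⟨hy.2, apAbnormal_spreadPoint hq hlim y⟩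
  refine le_of_forall_lt fun c hc => ?_
  obtain ⟨s, hcs, hs1⟩ := ENNReal.lt_iff_exists_nnreal_btwn.1 hc
  have hs0 : 0 < s := by
    have := (zero_le : 0 ≤ c).trans_lt hcs
    exact_mod_cast this
  obtain ⟨C, hC0, hC⟩ := abs_sub_le_spreadPoint hq hlim (s := s) hs0 (by exact_mod_cast hs1)
  exact hcs.trans_le ((le_dimH_image_of_antiHolder hY hs0 hC0
    fun y hy y' hy' => hC y hy.1 y' hy'.1).trans (dimH_mono hsub))

end CantorSeries

theorem mainTheorem2 (q : ℕ → ℕ) (hq : CantorSeries.IsBasicSequence q)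
    (hlim : CantorSeries.InfiniteInLimit q) :
    (∀ x : ℝ, CantorSeries.APNormalTypeI q x ↔ CantorSeries.APNormalTypeII q x) ∧
      IsMeagre (CantorSeries.normalAbnormalSet q) ∧
      volume (CantorSeries.normalAbnormalSet q) = 0 ∧
      dimH (CantorSeries.normalAbnormalSet q) = 1 :=
  ⟨CantorSeries.apNormalTypeI_iff_typeII hq hlim,
    (CantorSeries.isMeagre_distributionNormal hq).mono fun _ hx => hx.1,
    CantorSeries.volume_normalAbnormalSet hq hlim, CantorSeries.dimH_normalAbnormalSet hq hlim⟩
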